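/- Let $m,n,l\ge 1$ be integers, $\mathcal V=\{1,\dots,m\}$ a set of agents, and $\Theta\in\mathbb R^{l\times n}$ an unknown matrix. For each agent $i\in\mathcal V$ and time $t=1,2,\dots$ let $y_{i,t}=\Theta x_{i,t}+\eta_{i,t}$, where all the random vectors $x_{i,t}\sim\mathcal N(\mu_{i,t},\sigma_x^2 I_n)$ and $\eta_{i,t}\sim\mathcal N(0,\sigma_\eta^2 I_l)$ are mutually independent (over agents and times, and features independent of noises), $\sigma_x>0$, $\sigma_\eta\ge 0$, and the means $\mu_{i,t}\in\mathbb R^n$ are deterministic with $\hat\mu=\sup\{\|\mu_{i,t}\| : i\in\mathcal V,\ t\ge 1\}<\infty$. The local least-squares estimate of agent $i$ from its first $t$ samples is $$\hat\Theta_{i,t+1}=\Big(\sum_{j=1}^t y_{i,j}x_{i,j}^{*}\Big)\Big(\sum_{j=1}^t x_{i,j}x_{i,j}^{*}\Big)^{-1},$$ defined when $\sum_{j=1}^t x_{i,j}x_{i,j}^{*}$ is invertible. Write $\|\cdot\|$ for the spectral norm of a matrix and $\lambda_{\min}$ for the smallest eigenvalue. Theorem 1. Fix $\delta>0$ and let $t\ge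 1$ be an integer with $t\ge\max(t_1,t_2,t_3)$, where $$t_1=8n+16\log\tfrac{2}{\delta},\qquad t_2=\Big(\frac{16\hat\mu\big(\sqrt{4n}+\sqrt{2\log\frac{2}{\delta}}\big)}{\sigma_x}\Big)^2,\qquad t_3=2(n+l)\log\tfrac{1}{\delta}.$$ For any $i\in\mathcal V$, let $\bar\mu_{i,t}=\frac{4}{t\sigma_x^2}\sum_{j=1}^t\mu_{i,j}\mu_{i,j}^{*}$. Then with probability at least $1-4\delta$ the matrix $\sum_{j=1}^t x_{i,j}x_{i,j}^{*}$ is invertible and $$\|\hat\Theta_{i,t+1}-\Theta\|\le\frac{C_1}{\sqrt t\,\sigma_x^2\,\lambda_{\min}(I_n+\bar\mu_{i,t})},$$ where $$C_1=8\sigma_\eta\Big(4\sigma_x\sqrt{(n+l)\log\tfrac{9}{\delta}}+\hat\mu\big(\sqrt{2(l+n)}+2\sqrt{\log\tfrac{2}{\delta}}\big)\Big).$$ (For $\delta\ge\frac14$ the claim is vacuous, so square roots of negative logarithms play no role.) -/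

import Mathlib

open MeasureTheory ProbabilityTheory
open scoped Matrix Matrix.Norms.L2Operator

/-- The smallest eigenvalue of a real square matrix. It is only applied to the symmetric positive
definite matrix `I + μ̄`; on symmetric positive semidefinite matrices it is the smallest eigenvalue
and also the eigenvalue of smallest magnitude, see `lambdaMin_spec`. -/
noncomputable def lambdaMin {n : ℕ} (A : Matrix (Fin n) (Fin n) ℝ) : ℝ :=
  sInf (spectrum ℝ A)

theorem lambdaMin_spec {n : ℕ} (hn : 0 < n) (A : Matrix (Fin n) (Fin n) ℝ) (hA : A.PosSemidef) :
    lambdaMin A ∈ spectrum ℝ A ∧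
      ∀ ν ∈ spectrum ℝ A, lambdaMin A ≤ ν ∧ |lambdaMin A| ≤ |ν| := by
  have : Nonempty (Fin n) := ⟨⟨0, hn⟩⟩
  have hs : spectrum ℝ A = Set.range hA.isHermitian.eigenvalues :=
    hA.isHermitian.spectrum_real_eq_range_eigenvalues
  have hfin : (spectrum ℝ A).Finite := by
    rw [hs]; exact Set.finite_range _
  have hne : (spectrum ℝ A).Nonempty := by
    rw [hs]; exact Set.range_nonempty _
  have hnonneg : ∀ ν ∈ spectrum ℝ A, 0 ≤ ν := by
    intro ν hν
    rw [hs] at hν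
    obtain ⟨k, rfl⟩ := hν
    exact hA.eigenvalues_nonneg k
  have hmem : lambdaMin A ∈ spectrum ℝ A := hne.csInf_mem hfin
  refine ⟨hmem, fun ν hν => ?_⟩
  have hle : lambdaMin A ≤ ν := csInf_le hfin.bddBelow hν
  refine ⟨hle, ?_⟩
  rw [abs_of_nonneg (hnonneg _ hmem), abs_of_nonneg (hnonneg _ hν)]
  exact hle

/-- `∑_{j=1}^t u_j v_jᵀ`, for sequences of vectors `u_1, u_2, …` and `v_1, v_2, …`. -/
noncomputable def outerSum {p q : ℕ} (u : ℕ+ → EuclideanSpace ℝ (Fin p))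
    (v : ℕ+ → EuclideanSpace ℝ (Fin q)) (t : ℕ+) : Matrix (Fin p) (Fin q) ℝ :=
  ∑ j ∈ Finset.Icc 1 t, Matrix.vecMulVec (u j).ofLp (v j).ofLp

/-- The least squares estimate `Θ̂_{t+1} = (∑_{j=1}^t y_j x_jᵀ) (∑_{j=1}^t x_j x_jᵀ)⁻¹` computed from
the features `x_1, …, x_t` and the labels `y_1, …, y_t`; it is meaningful when
`∑_{j=1}^t x_j x_jᵀ` is invertible. -/
noncomputable def lsEstimate {n l : ℕ} (x : ℕ+ → EuclideanSpace ℝ (Fin n))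
    (y : ℕ+ → EuclideanSpace ℝ (Fin l)) (t : ℕ+) : Matrix (Fin l) (Fin n) ℝ :=
  outerSum y x t * (outerSum x x t)⁻¹

/-- `μ̄_t = 4 / (t σ_x²) ∑_{j=1}^t μ_j μ_jᵀ`. -/
noncomputable def muBar {n : ℕ} (σx : ℝ) (μ : ℕ+ → EuclideanSpace ℝ (Fin n)) (t : ℕ+) :
    Matrix (Fin n) (Fin n) ℝ :=
  (4 / (((t : ℕ) : ℝ) * σx ^ 2)) • outerSum μ μ t

/-- The constant `C₁` of the local error bound. -/
noncomputable def constC1 (n l : ℕ) (σx ση μhat δ : ℝ) : ℝ :=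
  8 * ση * (4 * σx * √(((n : ℝ) + l) * Real.log (9 / δ))
    + μhat * (√(2 * ((l : ℝ) + n)) + 2 * √(Real.log (2 / δ))))

/-!
Everything that enters the error of the estimate is a quadratic or bilinear form, so the matrices
are replaced by the linear maps `u ↦ ⟪u, xⱼ⟫` and the vectors are normalized to standard Gaussian
ones. Uniform control over all directions comes from a PAC-Bayes argument instead of a net: the
exponential moment of a sum is averaged over a small ball around each direction `u`, Jensen's
inequality exchanges average and exponential, and the price is the ratio of the volumes of two
balls, which does not depend on `u`. Because the forms are quadratic or bilinear, their average over
a ball is their value at the centre up to an explicit correction. This bounds from below the Gram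
form of the features and from above the correlation of features and noise; the terms containing the
deterministic means are linear in the Gaussian vectors and concentrate in Frobenius norm. On the
intersection of these events the cross terms are absorbed into the Gram form, and
`Θ̂ - Θ = (∑ ηⱼxⱼᵀ)(∑ xⱼxⱼᵀ)⁻¹` gives the bound.
-/

section GaussianLaplace

variable {E F : Type*}
  [NormedAddCommGroup E] [InnerProductSpace ℝ E] [FiniteDimensional ℝ E]
  [MeasurableSpace E] [BorelSpace E]
  [NormedAddCommGroup F] [InnerProductSpace ℝ F] [FiniteDimensional ℝ F]
  [MeasurableSpace F] [BorelSpace F]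

theorem lintegral_exp_sum_pi {ι : Type*} [Fintype ι] {X : ι → Type*}
    [∀ i, MeasurableSpace (X i)] (ν : ∀ i, Measure (X i)) [∀ i, IsProbabilityMeasure (ν i)]
    {φ : ∀ i, X i → ℝ} (hφ : ∀ i, Measurable (φ i)) :
    ∫⁻ x, ENNReal.ofReal (Real.exp (∑ i, φ i (x i))) ∂(Measure.pi ν)
      = ∏ i, ∫⁻ x, ENNReal.ofReal (Real.exp (φ i x)) ∂(ν i) := by
  have hm (i : ι) : Measurable fun x => ENNReal.ofReal (Real.exp (φ i x)) :=
    (hφ i).exp.ennreal_ofReal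
  simp_rw [Real.exp_sum, ENNReal.ofReal_prod_of_nonneg fun _ _ => (Real.exp_pos _).le]
  rw [lintegral_prod_eq_prod_lintegral_of_indepFun Finset.univ _
    (iIndepFun_pi fun i => (hm i).aemeasurable) fun i => (hm i).comp (measurable_pi_apply i)]
  exact Finset.prod_congr rfl fun i _ => (measurePreserving_eval ν i).lintegral_comp (hm i)

theorem lintegral_exp_mul_sq_gaussianReal {a : ℝ} (ha : a < 1 / 2) :
    ∫⁻ z, ENNReal.ofReal (Real.exp (a * z ^ 2)) ∂(gaussianReal 0 1)
      = ENNReal.ofReal (√(1 - 2 * a))⁻¹ := by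
  have hb : 0 < 1 / 2 - a := by linarith
  have hdensity (z : ℝ) :
      (gaussianPDF 0 1 * fun z => ENNReal.ofReal (Real.exp (a * z ^ 2))) z
        = ENNReal.ofReal ((√(2 * Real.pi))⁻¹ * Real.exp (-(1 / 2 - a) * z ^ 2)) := by
    rw [Pi.mul_apply, gaussianPDF, ← ENNReal.ofReal_mul (gaussianPDFReal_nonneg _ _ _),
      gaussianPDFReal, mul_assoc, ← Real.exp_add]
    congr 3
    · simp
    · simp; ring
  rw [gaussianReal_of_var_ne_zero _ one_ne_zero,
    lintegral_withDensity_eq_lintegral_mul _ (by fun_prop) (by fun_prop),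
    lintegral_congr hdensity,
    ← ofReal_integral_eq_lintegral_ofReal ((integrable_exp_neg_mul_sq hb).const_mul _)
      (ae_of_all _ fun z => by positivity),
    integral_const_mul, integral_gaussian, ← Real.sqrt_inv, ← Real.sqrt_mul (by positivity),
    ← Real.sqrt_inv]
  congr 2
  have := Real.pi_pos
  field_simp

theorem lintegral_exp_inner_stdGaussian (v : E) :
    ∫⁻ g, ENNReal.ofReal (Real.exp (inner ℝ v g)) ∂(stdGaussian E)
      = ENNReal.ofReal (Real.exp (‖v‖ ^ 2 / 2)) := by
  have hlaw : (stdGaussian E).map (innerSL ℝ v) = gaussianReal 0 (‖v‖ ^ 2).toNNReal := by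
    rw [IsGaussian.map_eq_gaussianReal, integral_strongDual_stdGaussian,
      variance_dual_stdGaussian, innerSL_apply_norm]
  have hint := integrable_exp_mul_gaussianReal (μ := 0) (v := (‖v‖ ^ 2).toNNReal) 1
  have hmgf := congrFun (mgf_id_gaussianReal (μ := 0) (v := (‖v‖ ^ 2).toNNReal)) 1
  simp only [one_mul] at hint
  simp only [mgf, id, one_mul] at hmgf
  calc ∫⁻ g, ENNReal.ofReal (Real.exp (inner ℝ v g)) ∂(stdGaussian E)
      = ∫⁻ z, ENNReal.ofReal (Real.exp z) ∂(gaussianReal 0 (‖v‖ ^ 2).toNNReal) := by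
        rw [← hlaw, lintegral_map (by fun_prop) (by fun_prop)]
        rfl
    _ = ENNReal.ofReal (Real.exp (‖v‖ ^ 2 / 2)) := by
        rw [← ofReal_integral_eq_lintegral_ofReal hint (ae_of_all _ fun z => (Real.exp_pos _).le),
          hmgf]
        simp

theorem lintegral_exp_sum_mul_inner_sq_stdGaussian {ι : Type*} [Fintype ι]
    (b : OrthonormalBasis ι ℝ E) {a : ι → ℝ} (ha : ∀ i, a i < 1 / 2) :
    ∫⁻ g, ENNReal.ofReal (Real.exp (∑ i, a i * inner ℝ (b i) g ^ 2)) ∂(stdGaussian E)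
      = ENNReal.ofReal (∏ i, (√(1 - 2 * a i))⁻¹) := by
  classical
  rw [stdGaussian_eq_map_pi_orthonormalBasis b, lintegral_map (by fun_prop) (by fun_prop)]
  have hcoord (z : ι → ℝ) (i : ι) : inner ℝ (b i) (∑ j, z j • b j) = z i :=
    b.orthonormal.inner_right_fintype z i
  simp_rw [hcoord]
  rw [lintegral_exp_sum_pi _ (φ := fun i z => a i * z ^ 2) fun i => by fun_prop,
    ENNReal.ofReal_prod_of_nonneg fun i _ => by positivity]
  exact Finset.prod_congr rfl fun i _ => lintegral_exp_mul_sq_gaussianReal (ha i)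

omit [MeasurableSpace E] [BorelSpace E] in
theorem exists_orthonormalBasis_eq_norm_smul (i₀ : Fin (Module.finrank ℝ E)) (θ : E) :
    ∃ b : OrthonormalBasis (Fin (Module.finrank ℝ E)) ℝ E, θ = ‖θ‖ • b i₀ := by
  set e := stdOrthonormalBasis ℝ E
  have hnorm : ‖‖θ‖ • e i₀‖ = ‖θ‖ := by simp [norm_smul]
  refine ⟨e.map (ℝ ∙ (‖θ‖ • e i₀ - θ))ᗮ.reflection, ?_⟩
  rw [OrthonormalBasis.map_apply, ← map_smul, Submodule.reflection_sub hnorm]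

theorem lintegral_exp_quadratic_stdGaussian {κ c : ℝ} (θ : E) (hκ : κ < 1 / 2)
    (hc : κ - c * ‖θ‖ ^ 2 < 1 / 2) :
    ∫⁻ g, ENNReal.ofReal (Real.exp (κ * ‖g‖ ^ 2 - c * inner ℝ θ g ^ 2)) ∂(stdGaussian E)
      = ENNReal.ofReal (√((1 - 2 * κ) / (1 - 2 * κ + 2 * c * ‖θ‖ ^ 2))
          * (√(1 - 2 * κ))⁻¹ ^ Module.finrank ℝ E) := by
  rcases isEmpty_or_nonempty (Fin (Module.finrank ℝ E)) with hd | ⟨⟨i₀⟩⟩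
  · have hd : Module.finrank ℝ E = 0 := by
      rw [← Fintype.card_fin (Module.finrank ℝ E), Fintype.card_eq_zero_iff.2 hd]
    have : Subsingleton E := Module.finrank_zero_iff.1 hd
    have h1 : (1 - 2 * κ) ≠ 0 := by linarith
    simp [hd, Subsingleton.elim _ (0 : E), h1]
  obtain ⟨b, hb⟩ := exists_orthonormalBasis_eq_norm_smul i₀ θ
  set a : Fin (Module.finrank ℝ E) → ℝ := fun i => if i = i₀ then κ - c * ‖θ‖ ^ 2 else κ
  have hdiag (g : E) :
      κ * ‖g‖ ^ 2 - c * inner ℝ θ g ^ 2 = ∑ i, a i * inner ℝ (b i) g ^ 2 := by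
    have hsplit (i) : a i * inner ℝ (b i) g ^ 2 = κ * inner ℝ (b i) g ^ 2
        - if i = i₀ then c * (‖θ‖ * inner ℝ (b i) g) ^ 2 else 0 := by
      simp only [a]; split_ifs <;> ring
    have hnorm : ∑ i, inner ℝ (b i) g ^ 2 = ‖g‖ ^ 2 := by
      exact b.sum_sq_inner_right g
    conv_lhs => rw [hb]
    simp [hsplit, Finset.sum_sub_distrib, ← Finset.mul_sum, hnorm, real_inner_smul_left]
  have ha (i) : a i < 1 / 2 := by simp only [a]; split_ifs <;> assumption
  have hκ0 : 0 < 1 - 2 * κ := by linarith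
  have hc0 : 0 < 1 - 2 * κ + 2 * c * ‖θ‖ ^ 2 := by linarith
  have hfactor (i) : (√(1 - 2 * a i))⁻¹
      = (if i = i₀ then √((1 - 2 * κ) / (1 - 2 * κ + 2 * c * ‖θ‖ ^ 2)) else 1)
        * (√(1 - 2 * κ))⁻¹ := by
    simp only [a]
    split_ifs
    · rw [show 1 - 2 * (κ - c * ‖θ‖ ^ 2) = 1 - 2 * κ + 2 * c * ‖θ‖ ^ 2 by ring,
        Real.sqrt_div hκ0.le]
      field_simp
    · rw [one_mul]
  simp_rw [hdiag]
  rw [lintegral_exp_sum_mul_inner_sq_stdGaussian b ha,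
    Finset.prod_congr rfl fun i _ => hfactor i, Finset.prod_mul_distrib]
  simp

theorem lintegral_exp_inner_mul_inner_stdGaussian {c : ℝ} {v : E} {w : F}
    (h : c ^ 2 * ‖v‖ ^ 2 * ‖w‖ ^ 2 < 1) :
    ∫⁻ p, ENNReal.ofReal (Real.exp (c * inner ℝ v p.1 * inner ℝ w p.2))
        ∂((stdGaussian E).prod (stdGaussian F))
      = ENNReal.ofReal (√(1 - c ^ 2 * ‖v‖ ^ 2 * ‖w‖ ^ 2))⁻¹ := by
  have hquad := lintegral_exp_quadratic_stdGaussian (κ := 0) (c := -(c ^ 2 * ‖w‖ ^ 2 / 2)) v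
    (by norm_num) (by linarith)
  simp only [zero_mul, zero_sub, neg_mul, neg_neg] at hquad
  calc _ = ∫⁻ x, ∫⁻ y, ENNReal.ofReal (Real.exp (inner ℝ ((c * inner ℝ v x) • w) y))
          ∂(stdGaussian F) ∂(stdGaussian E) := by
        rw [lintegral_prod _ (by fun_prop)]
        simp_rw [real_inner_smul_left]
    _ = ∫⁻ x, ENNReal.ofReal (Real.exp (c ^ 2 * ‖w‖ ^ 2 / 2 * inner ℝ v x ^ 2))
          ∂(stdGaussian E) := by
        refine lintegral_congr fun x => ?_
        rw [lintegral_exp_inner_stdGaussian, norm_smul, mul_pow, Real.norm_eq_abs, sq_abs]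
        ring_nf
    _ = _ := by
        rw [hquad]
        simp
        ring_nf

end GaussianLaplace

section UniformBall

theorem measurePreserving_cond {α β : Type*} [MeasurableSpace α] [MeasurableSpace β]
    {μ : Measure α} {ν : Measure β} {f : α → β} (hf : MeasurePreserving f μ ν) {s : Set β}
    (hs : MeasurableSet s) : MeasurePreserving f μ[|f ⁻¹' s] ν[|s] := by
  rw [ProbabilityTheory.cond, ProbabilityTheory.cond, hf.measure_preimage hs.nullMeasurableSet]
  exact (hf.restrict_preimage hs).smul_measure _

theorem prod_cond {α β : Type*} [MeasurableSpace α] [MeasurableSpace β]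
    {μ : Measure α} {ν : Measure β} [SFinite μ] [SFinite ν] {s : Set α} {t : Set β}
    (hs₀ : μ s ≠ 0) (hs : μ s ≠ ⊤) : μ[|s].prod ν[|t] = (μ.prod ν)[|s ×ˢ t] := by
  rw [ProbabilityTheory.cond, ProbabilityTheory.cond, ProbabilityTheory.cond,
    Measure.prod_smul_left, Measure.prod_smul_right, smul_smul, Measure.prod_restrict,
    Measure.prod_prod, ENNReal.mul_inv (.inl hs₀) (.inl hs)]

/-- The uniform distribution on the closed ball of centre `u` and radius `r`. These are the
posteriors over which exponential moments are averaged; it is a probability measure only for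
`0 < r`. -/
noncomputable def uniformBall {V : Type*} [PseudoMetricSpace V] [MeasureSpace V] (u : V) (r : ℝ) :
    Measure V :=
  volume[|Metric.closedBall u r]

variable {V W : Type*}
  [NormedAddCommGroup V] [NormedSpace ℝ V] [FiniteDimensional ℝ V]
  [MeasureSpace V] [BorelSpace V] [(volume : Measure V).IsAddHaarMeasure]
  [NormedAddCommGroup W] [NormedSpace ℝ W] [FiniteDimensional ℝ W]
  [MeasureSpace W] [BorelSpace W] [(volume : Measure W).IsAddHaarMeasure]
  {r : ℝ}

omit [BorelSpace V] in
theorem isProbabilityMeasure_uniformBall (u : V) (hr : 0 < r) :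
    IsProbabilityMeasure (uniformBall u r) :=
  cond_isProbabilityMeasure_of_finite (Metric.measure_closedBall_pos _ _ hr).ne'
    measure_closedBall_lt_top.ne

omit [NormedSpace ℝ V] [FiniteDimensional ℝ V] [Measure.IsAddHaarMeasure (volume : Measure V)] in
theorem ae_mem_closedBall_uniformBall (u : V) :
    ∀ᵐ θ ∂(uniformBall u r), θ ∈ Metric.closedBall u r :=
  ae_cond_mem Metric.isClosed_closedBall.measurableSet

theorem integrable_uniformBall {f : V → ℝ} (hf : Continuous f) (u : V) (hr : 0 < r) :
    Integrable f (uniformBall u r) :=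
  (hf.continuousOn.integrableOn_compact (isCompact_closedBall u r)).smul_measure
    (ENNReal.inv_ne_top.2 (Metric.measure_closedBall_pos _ _ hr).ne')

instance isAddHaarMeasure_volume_prod : (volume : Measure (V × W)).IsAddHaarMeasure :=
  inferInstanceAs ((volume : Measure V).prod (volume : Measure W)).IsAddHaarMeasure

omit [BorelSpace V] [BorelSpace W] in
theorem uniformBall_prod (u : V) (w : W) (hr : 0 < r) :
    uniformBall (u, w) r = (uniformBall u r).prod (uniformBall w r) := by
  rw [uniformBall, ← closedBall_prod_same, Measure.volume_eq_prod]
  exact (prod_cond (Metric.measure_closedBall_pos _ _ hr).ne' measure_closedBall_lt_top.ne).symm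

theorem integral_uniformBall_eq_integral_symm (u : V) {f : V → ℝ} (hf : Continuous f)
    (hr : 0 < r) :
    ∫ θ, f θ ∂(uniformBall u r) = ∫ b, (f (u + b) + f (u - b)) / 2 ∂(uniformBall 0 r) := by
  have hmap {e : V ≃ₜ V} (he : MeasurePreserving e volume volume)
      (hball : e ⁻¹' Metric.closedBall u r = Metric.closedBall 0 r) :
      ∫ b, f (e b) ∂(uniformBall 0 r) = ∫ θ, f θ ∂(uniformBall u r) := by
    have h := measurePreserving_cond he (Metric.isClosed_closedBall (x := u) (ε := r)).measurableSet
    rw [hball] at h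
    exact h.integral_comp e.measurableEmbedding f
  have hadd : ∫ b, f (u + b) ∂(uniformBall 0 r) = ∫ θ, f θ ∂(uniformBall u r) :=
    hmap (e := Homeomorph.addLeft u) (measurePreserving_add_left volume u) (by ext; simp)
  have hsub : ∫ b, f (u - b) ∂(uniformBall 0 r) = ∫ θ, f θ ∂(uniformBall u r) :=
    hmap (e := Homeomorph.subLeft u) (volume.measurePreserving_sub_left u)
      (by ext; simp [dist_eq_norm])
  rw [integral_div, integral_add (integrable_uniformBall (by fun_prop) 0 hr)
    (integrable_uniformBall (by fun_prop) 0 hr), hadd, hsub]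
  ring

end UniformBall

section UniformBallInner

theorem log_le_log_add_log_one_add_norm_sq {E : Type*} [NormedAddCommGroup E]
    [InnerProductSpace ℝ E] {u b : E} (hu : ‖u‖ = 1) (hb : ‖b‖ ≤ 1 / 4) :
    Real.log (561 / 64) ≤ Real.log (1 + 2 * ‖u + b‖ ^ 2) + Real.log (1 + 2 * ‖u - b‖ ^ 2) := by
  have hinner : inner ℝ u b ^ 2 ≤ ‖b‖ ^ 2 := by
    rw [← sq_abs]
    gcongr
    simpa [hu] using abs_real_inner_le_norm u b
  have hb2 : ‖b‖ ^ 2 ≤ 1 / 16 := by nlinarith [norm_nonneg b]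
  rw [← Real.log_mul (by positivity) (by positivity), norm_add_sq_real, norm_sub_sq_real, hu]
  refine Real.log_le_log (by norm_num) ?_
  nlinarith [sq_nonneg ‖b‖]

variable {E : Type*}
  [NormedAddCommGroup E] [InnerProductSpace ℝ E] [FiniteDimensional ℝ E]
  [MeasurableSpace E] [BorelSpace E]
  {r : ℝ}

theorem integral_inner_uniformBall (a u : E) (hr : 0 < r) :
    ∫ θ, inner ℝ a θ ∂(uniformBall u r) = inner ℝ a u := by
  have := isProbabilityMeasure_uniformBall (0 : E) hr
  rw [integral_uniformBall_eq_integral_symm u (by fun_prop) hr]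
  simp [inner_add_right, inner_sub_right]

theorem integral_inner_sq_uniformBall_zero_eq {a b : E} (h : ‖a‖ = ‖b‖) :
    ∫ θ, inner ℝ a θ ^ 2 ∂(uniformBall 0 r) = ∫ θ, inner ℝ b θ ^ 2 ∂(uniformBall 0 r) := by
  let R : E ≃ₗᵢ[ℝ] E := (ℝ ∙ (b - a))ᗮ.reflection
  have hR : R b = a := Submodule.reflection_sub h.symm
  have hpres := measurePreserving_cond R.measurePreserving
    (Metric.isClosed_closedBall (x := (0 : E)) (ε := r)).measurableSet
  rw [R.preimage_closedBall, map_zero] at hpres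
  rw [uniformBall, ← hpres.integral_comp R.toHomeomorph.measurableEmbedding, ← hR]
  simp only [R.inner_map_map]

theorem integral_inner_sq_uniformBall_zero_le [Nontrivial E] (a : E) (hr : 0 < r) :
    ∫ θ, inner ℝ a θ ^ 2 ∂(uniformBall 0 r) ≤ r ^ 2 / Module.finrank ℝ E * ‖a‖ ^ 2 := by
  have := isProbabilityMeasure_uniformBall (0 : E) hr
  have hd : (0 : ℝ) < Module.finrank ℝ E := by exact_mod_cast Module.finrank_pos
  let e := stdOrthonormalBasis ℝ E
  rw [div_mul_eq_mul_div, le_div_iff₀ hd]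
  calc (∫ θ, inner ℝ a θ ^ 2 ∂(uniformBall 0 r)) * Module.finrank ℝ E
      = ∑ i, ∫ θ, inner ℝ (‖a‖ • e i) θ ^ 2 ∂(uniformBall 0 r) := by
        rw [Finset.sum_congr rfl fun i _ => integral_inner_sq_uniformBall_zero_eq
          (show ‖‖a‖ • e i‖ = ‖a‖ by simp [norm_smul])]
        simp [mul_comm]
    _ = ∫ θ, ‖a‖ ^ 2 * ‖θ‖ ^ 2 ∂(uniformBall (0 : E) r) := by
        rw [← integral_finsetSum _ fun i _ => integrable_uniformBall (by fun_prop) 0 hr]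
        simp_rw [real_inner_smul_left, mul_pow, ← Finset.mul_sum, e.sum_sq_inner_right]
    _ ≤ ∫ θ, ‖a‖ ^ 2 * r ^ 2 ∂(uniformBall (0 : E) r) := by
        refine integral_mono_ae (integrable_uniformBall (by fun_prop) 0 hr) (integrable_const _) ?_
        filter_upwards [ae_mem_closedBall_uniformBall (0 : E)] with θ hθ
        have : ‖θ‖ ≤ r := by simpa using hθ
        gcongr
    _ = r ^ 2 * ‖a‖ ^ 2 := by rw [integral_const, probReal_univ, one_smul, mul_comm]

theorem integral_inner_sq_uniformBall_le [Nontrivial E] (a u : E) (hr : 0 < r) :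
    ∫ θ, inner ℝ a θ ^ 2 ∂(uniformBall u r)
      ≤ inner ℝ a u ^ 2 + r ^ 2 / Module.finrank ℝ E * ‖a‖ ^ 2 := by
  have := isProbabilityMeasure_uniformBall (0 : E) hr
  have hpar (b : E) : (inner ℝ a (u + b) ^ 2 + inner ℝ a (u - b) ^ 2) / 2
      = inner ℝ a u ^ 2 + inner ℝ a b ^ 2 := by
    rw [inner_add_right, inner_sub_right]
    ring
  rw [integral_uniformBall_eq_integral_symm u (by fun_prop) hr]
  simp_rw [hpar]
  rw [integral_add (integrable_const _) (integrable_uniformBall (by fun_prop) 0 hr)]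
  simpa using integral_inner_sq_uniformBall_zero_le a hr

theorem le_integral_log_one_add_norm_sq_uniformBall {u : E} (hu : ‖u‖ = 1) :
    1 / 2 * Real.log (561 / 64)
      ≤ ∫ θ, Real.log (1 + 2 * ‖θ‖ ^ 2) ∂(uniformBall u (1 / 4)) := by
  have hr : (0 : ℝ) < 1 / 4 := by norm_num
  have := isProbabilityMeasure_uniformBall (0 : E) hr
  have hlog : Continuous fun θ : E => Real.log (1 + 2 * ‖θ‖ ^ 2) :=
    Continuous.log (by fun_prop) fun θ => by positivity
  rw [integral_uniformBall_eq_integral_symm u hlog hr]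
  calc 1 / 2 * Real.log (561 / 64)
      = ∫ b : E, 1 / 2 * Real.log (561 / 64) ∂(uniformBall 0 (1 / 4)) := by
        rw [integral_const, probReal_univ, one_smul]
    _ ≤ _ := by
        refine integral_mono_ae (integrable_const _)
          (integrable_uniformBall (((hlog.comp (by fun_prop)).add
            (hlog.comp (by fun_prop))).div_const 2) 0 hr) ?_
        filter_upwards [ae_mem_closedBall_uniformBall (0 : E)] with b hb
        have := log_le_log_add_log_one_add_norm_sq hu (b := b) (by simpa using hb)
        linarith

end UniformBallInner

section PACBayes

variable {V : Type*} [NormedAddCommGroup V] [NormedSpace ℝ V] [FiniteDimensional ℝ V]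
  [MeasureSpace V] [BorelSpace V] [(volume : Measure V).IsAddHaarMeasure]
  {r R δ : ℝ}

theorem volume_closedBall_zero_add (u : V) (hr : 0 < r) (hR : 0 ≤ R) :
    volume (Metric.closedBall (0 : V) (R + r))
      = ENNReal.ofReal (((R + r) / r) ^ Module.finrank ℝ V) * volume (Metric.closedBall u r) := by
  rw [Measure.addHaar_closedBall _ _ hr.le, Measure.addHaar_closedBall _ _ (by positivity),
    ← mul_assoc, ← ENNReal.ofReal_mul (by positivity), ← mul_pow, div_mul_cancel₀ _ hr.ne']

theorem volume_mul_exp_integral_uniformBall_le {f : V → ℝ} (hf : Continuous f) (u : V)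
    (hr : 0 < r) :
    volume (Metric.closedBall u r) * ENNReal.ofReal (Real.exp (∫ θ, f θ ∂(uniformBall u r)))
      ≤ ∫⁻ θ in Metric.closedBall u r, ENNReal.ofReal (Real.exp (f θ)) := by
  have := isProbabilityMeasure_uniformBall u hr
  have hint : Integrable (fun θ => Real.exp (f θ)) (uniformBall u r) :=
    integrable_uniformBall (by fun_prop) u hr
  have hjensen : Real.exp (∫ θ, f θ ∂(uniformBall u r)) ≤ ∫ θ, Real.exp (f θ) ∂(uniformBall u r) :=
    convexOn_exp.map_integral_le Real.continuous_exp.continuousOn isClosed_univ (by simp)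
      (integrable_uniformBall hf u hr) hint
  calc volume (Metric.closedBall u r) * ENNReal.ofReal (Real.exp (∫ θ, f θ ∂(uniformBall u r)))
      ≤ volume (Metric.closedBall u r)
          * ENNReal.ofReal (∫ θ, Real.exp (f θ) ∂(uniformBall u r)) := by gcongr
    _ = volume (Metric.closedBall u r) * ((volume (Metric.closedBall u r))⁻¹
          * ∫⁻ θ in Metric.closedBall u r, ENNReal.ofReal (Real.exp (f θ))) := by
        rw [ofReal_integral_eq_lintegral_ofReal hint (ae_of_all _ fun _ => (Real.exp_pos _).le),
          uniformBall, ProbabilityTheory.cond, lintegral_smul_measure, smul_eq_mul]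
    _ = _ := by
        rw [← mul_assoc, ENNReal.mul_inv_cancel (Metric.measure_closedBall_pos _ _ hr).ne'
          measure_closedBall_lt_top.ne, one_mul]

theorem measure_mul_one_div_le_setLIntegral_le {Ω Θ : Type*} [MeasurableSpace Ω]
    [MeasurableSpace Θ] (P : Measure Ω) [SFinite P] (μ : Measure Θ) [SFinite μ] {s : Set Θ}
    (hs : MeasurableSet s) (hs₀ : μ s ≠ 0) (hs' : μ s ≠ ⊤) {δ : ℝ} (hδ : 0 < δ)
    {F : Ω → Θ → ENNReal} (hF : Measurable (Function.uncurry F))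
    (hle : ∀ θ ∈ s, ∫⁻ ω, F ω θ ∂P ≤ 1) :
    P {ω | μ s * ENNReal.ofReal (1 / δ) ≤ ∫⁻ θ in s, F ω θ ∂μ} ≤ ENNReal.ofReal δ := by
  have hδ' : ENNReal.ofReal δ * ENNReal.ofReal (1 / δ) = 1 := by
    rw [← ENNReal.ofReal_mul hδ.le, mul_one_div_cancel hδ.ne', ENNReal.ofReal_one]
  refine (meas_ge_le_lintegral_div hF.lintegral_prod_right'.aemeasurable
    (mul_ne_zero hs₀ (right_ne_zero_of_mul_eq_one hδ'))
    (ENNReal.mul_ne_top hs' ENNReal.ofReal_ne_top)).trans (ENNReal.div_le_of_le_mul ?_)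
  calc ∫⁻ ω, ∫⁻ θ in s, F ω θ ∂μ ∂P
      = ∫⁻ θ in s, ∫⁻ ω, F ω θ ∂P ∂μ := lintegral_lintegral_swap hF.aemeasurable
    _ ≤ ∫⁻ _ in s, 1 ∂μ := setLIntegral_mono' hs hle
    _ = ENNReal.ofReal δ * (μ s * ENNReal.ofReal (1 / δ)) := by
        rw [setLIntegral_one, mul_left_comm, hδ', mul_one]

-- Replacing Lebesgue measure on the ball of radius `R + r` by the uniform distribution on a ball
-- of radius `r` inside it costs the logarithm of the ratio of the volumes, uniformly in the ball.
theorem measure_exists_lt_integral_uniformBall_le {Ω : Type*} [MeasurableSpace Ω] (P : Measure Ω)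
    [SFinite P] (hr : 0 < r) (hR : 0 ≤ R) (hδ : 0 < δ) {f : Ω → V → ℝ}
    (hf : Measurable (Function.uncurry f)) (hfc : ∀ ω, Continuous (f ω))
    (hexp : ∀ θ, ‖θ‖ ≤ R + r → ∫⁻ ω, ENNReal.ofReal (Real.exp (f ω θ)) ∂P ≤ 1) :
    P {ω | ∃ u, ‖u‖ ≤ R ∧ Module.finrank ℝ V * Real.log ((R + r) / r) + Real.log (1 / δ)
        < ∫ θ, f ω θ ∂(uniformBall u r)} ≤ ENNReal.ofReal δ := by
  refine (measure_mono ?_).trans (measure_mul_one_div_le_setLIntegral_le P volume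
    (Metric.isClosed_closedBall (x := (0 : V)) (ε := R + r)).measurableSet
    (Metric.measure_closedBall_pos _ _ (by positivity)).ne' measure_closedBall_lt_top.ne hδ
    (F := fun ω θ => ENNReal.ofReal (Real.exp (f ω θ))) hf.exp.ennreal_ofReal
    fun θ hθ => hexp θ (by simpa using hθ))
  rintro ω ⟨u, hu, hlt⟩
  calc volume (Metric.closedBall (0 : V) (R + r)) * ENNReal.ofReal (1 / δ)
      = volume (Metric.closedBall u r) * ENNReal.ofReal (Real.exp
          (Module.finrank ℝ V * Real.log ((R + r) / r) + Real.log (1 / δ))) := by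
        rw [volume_closedBall_zero_add u hr hR, Real.exp_add, Real.exp_nat_mul,
          Real.exp_log (by positivity), Real.exp_log (by positivity),
          ENNReal.ofReal_mul (by positivity)]
        ring
    _ ≤ volume (Metric.closedBall u r)
          * ENNReal.ofReal (Real.exp (∫ θ, f ω θ ∂(uniformBall u r))) := by gcongr
    _ ≤ ∫⁻ θ in Metric.closedBall u r, ENNReal.ofReal (Real.exp (f ω θ)) :=
        volume_mul_exp_integral_uniformBall_le (hfc ω) u hr
    _ ≤ ∫⁻ θ in Metric.closedBall 0 (R + r), ENNReal.ofReal (Real.exp (f ω θ)) :=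
        lintegral_mono_set
          (Metric.closedBall_subset_closedBall' (by rw [dist_zero_right]; linarith))

theorem measure_pi_exists_lt_sum_integral_uniformBall_le {ι X : Type*} [Fintype ι]
    [MeasurableSpace X] (ν : Measure X) [IsProbabilityMeasure ν] (hr : 0 < r) (hR : 0 ≤ R)
    (hδ : 0 < δ) {φ : X → V → ℝ} (hφ : Measurable (Function.uncurry φ))
    (hφc : ∀ x, Continuous (φ x))
    (hexp : ∀ θ, ‖θ‖ ≤ R + r → ∫⁻ x, ENNReal.ofReal (Real.exp (φ x θ)) ∂ν ≤ 1) :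
    Measure.pi (fun _ : ι => ν) {g | ∃ u, ‖u‖ ≤ R ∧
        Module.finrank ℝ V * Real.log ((R + r) / r) + Real.log (1 / δ)
          < ∑ j, ∫ θ, φ (g j) θ ∂(uniformBall u r)} ≤ ENNReal.ofReal δ := by
  have hmeas : Measurable (Function.uncurry fun (g : ι → X) θ => ∑ j, φ (g j) θ) :=
    Finset.measurable_fun_sum _ fun j _ =>
      hφ.comp (f := fun p : (ι → X) × V => (p.1 j, p.2)) (by fun_prop)
  have h := measure_exists_lt_integral_uniformBall_le (Measure.pi fun _ : ι => ν) hr hR hδ hmeas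
    (fun g => continuous_finsetSum _ fun j _ => hφc (g j)) fun θ hθ => by
      rw [lintegral_exp_sum_pi (fun _ => ν) (φ := fun _ x => φ x θ) fun _ =>
        hφ.comp measurable_prodMk_right]
      exact Finset.prod_le_one' fun _ _ => hexp θ hθ
  simpa only [integral_finsetSum Finset.univ fun _ _ =>
    integrable_uniformBall (hφc _) _ hr] using h

end PACBayes

section LeastSingularValue

theorem seven_div_eight_le_one_sub_inv_pow {n : ℕ} (hn : 0 < n) :
    (7 / 8 : ℝ) ≤ (1 - 2 * (1 / (16 * (n : ℝ)))) ^ n := by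
  have hn' : (1 : ℝ) ≤ n := by exact_mod_cast hn
  have hinv : 1 / (16 * (n : ℝ)) ≤ 1 / 16 :=
    one_div_le_one_div_of_le (by norm_num) (by linarith)
  calc (7 / 8 : ℝ) = 1 + n * -(2 * (1 / (16 * (n : ℝ)))) := by field_simp; norm_num
    _ ≤ (1 + -(2 * (1 / (16 * (n : ℝ))))) ^ n := one_add_mul_le_pow (by linarith) n
    _ = _ := by rw [← sub_eq_add_neg]

theorem two_add_log_five_le :
    2 + Real.log 5 ≤ 2 * Real.log (561 / 64) + 4 * Real.log (7 / 8) := by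
  have he : Real.exp 2 < 7.39 := by
    rw [show (2 : ℝ) = 1 + 1 by norm_num, Real.exp_add]
    nlinarith [Real.exp_one_lt_d9, Real.exp_pos 1]
  calc 2 + Real.log 5 = Real.log (Real.exp 2 * 5) := by
        rw [Real.log_mul (Real.exp_pos 2).ne' (by norm_num), Real.log_exp]
    _ ≤ Real.log ((561 / 64) ^ 2 * (7 / 8) ^ 4) :=
        Real.log_le_log (by positivity) (by norm_num at he ⊢; linarith)
    _ = _ := by
        rw [Real.log_mul (by norm_num) (by norm_num), Real.log_pow, Real.log_pow]
        norm_num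

variable {E : Type*} [NormedAddCommGroup E] [InnerProductSpace ℝ E] [FiniteDimensional ℝ E]
  [MeasurableSpace E] [BorelSpace E] [Nontrivial E]

omit [FiniteDimensional ℝ E] [MeasurableSpace E] [BorelSpace E] [Nontrivial E] in
/-- The exponent for the lower bound on `∑ j, ⟪u, x j⟫ ^ 2`: the logarithms normalise its
exponential moment under a Gaussian `x`, and the multiple of `‖x‖ ^ 2` is what averaging
`-⟪x, θ⟫ ^ 2` over a ball of radius `1 / 4` in `θ` costs. -/
noncomputable def gramExponent (x θ : E) : ℝ :=
  1 / (16 * Module.finrank ℝ E) * ‖x‖ ^ 2 - inner ℝ x θ ^ 2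
    + 1 / 2 * Real.log (1 + 2 * ‖θ‖ ^ 2) + 1 / 2 * Real.log (7 / 8)

omit [FiniteDimensional ℝ E] [MeasurableSpace E] [BorelSpace E] [Nontrivial E] in
theorem continuous_gramExponent :
    Continuous (Function.uncurry (gramExponent : E → E → ℝ)) := by
  have hlog : Continuous fun p : E × E => Real.log (1 + 2 * ‖p.2‖ ^ 2) :=
    Continuous.log (by fun_prop) fun p => by positivity
  unfold gramExponent Function.uncurry
  fun_prop

theorem lintegral_exp_gramExponent_le_one (θ : E) :
    ∫⁻ x, ENNReal.ofReal (Real.exp (gramExponent x θ)) ∂(stdGaussian E) ≤ 1 := by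
  have hn : 0 < Module.finrank ℝ E := Module.finrank_pos
  have hn' : (1 : ℝ) ≤ Module.finrank ℝ E := by exact_mod_cast hn
  have hpow := seven_div_eight_le_one_sub_inv_pow hn
  set n := Module.finrank ℝ E with hn_def
  set κ : ℝ := 1 / (16 * n)
  have hκ₀ : 0 ≤ κ := by positivity
  have hκ₁ : κ ≤ 1 / 16 := one_div_le_one_div_of_le (by norm_num) (by linarith)
  have hk : 0 < 1 - 2 * κ := by linarith
  have hexp (x : E) : Real.exp (gramExponent x θ) = Real.exp (κ * ‖x‖ ^ 2 - 1 * inner ℝ θ x ^ 2)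
      * (√(1 + 2 * ‖θ‖ ^ 2) * √(7 / 8)) := by
    rw [gramExponent, add_assoc, Real.exp_add, Real.exp_add, one_div_mul_eq_div 2 (Real.log _),
      one_div_mul_eq_div 2 (Real.log _), Real.exp_half, Real.exp_half,
      Real.exp_log (by positivity), Real.exp_log (by norm_num), one_mul, real_inner_comm]
  simp_rw [hexp, ENNReal.ofReal_mul (Real.exp_pos _).le]
  rw [lintegral_mul_const _ (by fun_prop),
    lintegral_exp_quadratic_stdGaussian θ (by linarith)
      (by nlinarith [sq_nonneg ‖θ‖]), ← hn_def,
    ← ENNReal.ofReal_mul (by positivity), ← ENNReal.ofReal_one]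
  refine ENNReal.ofReal_le_ofReal ?_
  calc √((1 - 2 * κ) / (1 - 2 * κ + 2 * 1 * ‖θ‖ ^ 2)) * (√(1 - 2 * κ))⁻¹ ^ n
        * (√(1 + 2 * ‖θ‖ ^ 2) * √(7 / 8))
      = √((1 - 2 * κ) / (1 - 2 * κ + 2 * 1 * ‖θ‖ ^ 2) * (1 + 2 * ‖θ‖ ^ 2))
        * (√(1 - 2 * κ) ^ n)⁻¹ * √(7 / 8) := by
        rw [Real.sqrt_mul (by positivity), inv_pow]
        ring
    _ ≤ 1 * (√(1 - 2 * κ) ^ n)⁻¹ * √(1 - 2 * κ) ^ n := by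
        gcongr
        · rw [Real.sqrt_le_one, div_mul_eq_mul_div, div_le_one (by positivity)]
          nlinarith [sq_nonneg ‖θ‖]
        · rw [Real.sqrt_le_left (by positivity), ← pow_mul, mul_comm n, pow_mul,
            Real.sq_sqrt hk.le]
          exact hpow
    _ = 1 := by
        rw [one_mul, inv_mul_cancel₀ (by positivity)]

theorem le_integral_gramExponent_uniformBall (x : E) {u : E} (hu : ‖u‖ = 1) :
    1 / 4 + 1 / 8 * Real.log 5 - inner ℝ x u ^ 2
      ≤ ∫ θ, gramExponent x θ ∂(uniformBall u (1 / 4)) := by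
  have hr : (0 : ℝ) < 1 / 4 := by norm_num
  have := isProbabilityMeasure_uniformBall u hr
  have hlog : Continuous fun θ : E => Real.log (1 + 2 * ‖θ‖ ^ 2) :=
    Continuous.log (by fun_prop) fun θ => by positivity
  have hint {f : E → ℝ} (hf : Continuous f) : Integrable f (uniformBall u (1 / 4)) :=
    integrable_uniformBall hf u hr
  have hsq := integral_inner_sq_uniformBall_le x u hr
  have hlog_avg := le_integral_log_one_add_norm_sq_uniformBall hu
  have hκ : ((1 / 4) ^ 2 / Module.finrank ℝ E : ℝ) = 1 / (16 * Module.finrank ℝ E) := by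
    field_simp
    norm_num
  rw [hκ] at hsq
  simp only [gramExponent]
  rw [integral_add (hint (by fun_prop)) (hint (by fun_prop)),
    integral_add (hint (by fun_prop)) (hint (by fun_prop)),
    integral_sub (hint (by fun_prop)) (hint (by fun_prop)), integral_const_mul (1 / 2),
    integral_const, integral_const, probReal_univ, one_smul, one_smul]
  linarith [two_add_log_five_le]

theorem one_le_log_five : 1 ≤ Real.log 5 := by
  rw [Real.le_log_iff_exp_le (by norm_num)]
  linarith [Real.exp_one_lt_d9]

theorem measure_exists_sum_inner_sq_lt_le {ι : Type*} [Fintype ι] {δ : ℝ} (hδ : 0 < δ)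
    (hδ₁ : δ ≤ 1)
    (hι : 8 * (Module.finrank ℝ E : ℝ) + 8 * Real.log (1 / δ) ≤ Fintype.card ι) :
    Measure.pi (fun _ : ι => stdGaussian E)
      {g | ∃ u, ∑ j, inner ℝ u (g j) ^ 2 < Fintype.card ι / 4 * ‖u‖ ^ 2}
      ≤ ENNReal.ofReal δ := by
  refine (measure_mono ?_).trans (measure_pi_exists_lt_sum_integral_uniformBall_le
    (stdGaussian E) (r := 1 / 4) (R := 1) (by norm_num) zero_le_one hδ
    continuous_gramExponent.measurable (fun x => by
      exact continuous_gramExponent.comp (Continuous.prodMk_right x))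
    fun θ _ => lintegral_exp_gramExponent_le_one θ)
  rintro g ⟨u, hu⟩
  have hu₀ : u ≠ 0 := by rintro rfl; simp at hu
  have hunit : ‖‖u‖⁻¹ • u‖ = 1 := norm_smul_inv_norm hu₀
  have hlt : ∑ j, inner ℝ (g j) (‖u‖⁻¹ • u) ^ 2 < Fintype.card ι / 4 := by
    simp_rw [real_inner_smul_right, mul_pow, ← Finset.mul_sum, inv_pow]
    rw [inv_mul_lt_iff₀' (by positivity)]
    simpa only [real_inner_comm] using hu
  have hlogδ : 0 ≤ Real.log (1 / δ) := Real.log_nonneg (one_le_one_div hδ hδ₁)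
  refine ⟨‖u‖⁻¹ • u, hunit.le, ?_⟩
  calc Module.finrank ℝ E * Real.log ((1 + 1 / 4) / (1 / 4)) + Real.log (1 / δ)
      = Module.finrank ℝ E * Real.log 5 + Real.log (1 / δ) := by norm_num
    _ ≤ Fintype.card ι / 8 * Real.log 5 := by nlinarith [one_le_log_five]
    _ < ∑ j, (1 / 4 + 1 / 8 * Real.log 5 - inner ℝ (g j) (‖u‖⁻¹ • u) ^ 2) := by
        rw [Finset.sum_sub_distrib, Finset.sum_const, Finset.card_univ, nsmul_eq_mul]
        linarith
    _ ≤ _ := Finset.sum_le_sum fun j _ => le_integral_gramExponent_uniformBall (g j) hunit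

end LeastSingularValue

section ProductOfGaussians

theorem neg_two_mul_le_log_one_sub {x : ℝ} (h₀ : 0 ≤ x) (h₁ : x ≤ 1 / 2) :
    -(2 * x) ≤ Real.log (1 - x) := by
  refine le_trans ?_ (Real.one_sub_inv_le_log_of_pos (by linarith))
  rw [neg_le_sub_iff_le_add, inv_le_iff_one_le_mul₀ (by linarith)]
  nlinarith

theorem one_le_log_three : 1 ≤ Real.log 3 := by
  rw [Real.le_log_iff_exp_le (by norm_num)]
  linarith [Real.exp_one_lt_d9]

theorem log_nine_div {δ : ℝ} (hδ : 0 < δ) :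
    Real.log (9 / δ) = 2 * Real.log 3 + Real.log (1 / δ) := by
  rw [show 9 / δ = 3 ^ 2 * (1 / δ) by ring, Real.log_mul (by norm_num) (by positivity),
    Real.log_pow]
  norm_num

section Exponent

variable {E F : Type*} [NormedAddCommGroup E] [InnerProductSpace ℝ E] [NormedAddCommGroup F]
  [InnerProductSpace ℝ F]

/-- The exponent for the upper bound on `∑ j, ⟪u, x j⟫ * ⟪v, y j⟫`: the logarithm normalises its
exponential moment under independent standard Gaussian vectors, for every `θ` of norm at most
`3 / 2`. -/
noncomputable def productExponent (c : ℝ) (w θ : E × F) : ℝ :=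
  c * inner ℝ θ.1 w.1 * inner ℝ θ.2 w.2 + 1 / 2 * Real.log (1 - c ^ 2 * (81 / 16))

theorem continuous_productExponent (c : ℝ) :
    Continuous (Function.uncurry (productExponent c : E × F → E × F → ℝ)) := by
  unfold productExponent Function.uncurry
  fun_prop

variable [FiniteDimensional ℝ E] [MeasurableSpace E] [BorelSpace E]
  [FiniteDimensional ℝ F] [MeasurableSpace F] [BorelSpace F]

theorem lintegral_exp_productExponent_le_one {c : ℝ} (hc : c ^ 2 * (81 / 16) < 1) {θ : E × F}
    (hθ : ‖θ‖ ≤ 3 / 2) :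
    ∫⁻ w, ENNReal.ofReal (Real.exp (productExponent c w θ))
      ∂((stdGaussian E).prod (stdGaussian F)) ≤ 1 := by
  have hfst : ‖θ.1‖ ≤ 3 / 2 := (norm_fst_le θ).trans hθ
  have hsnd : ‖θ.2‖ ≤ 3 / 2 := (norm_snd_le θ).trans hθ
  have hle : c ^ 2 * ‖θ.1‖ ^ 2 * ‖θ.2‖ ^ 2 ≤ c ^ 2 * (81 / 16) := by
    calc c ^ 2 * ‖θ.1‖ ^ 2 * ‖θ.2‖ ^ 2 ≤ c ^ 2 * (3 / 2) ^ 2 * (3 / 2) ^ 2 := by gcongr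
      _ = c ^ 2 * (81 / 16) := by ring
  simp_rw [productExponent, Real.exp_add, ENNReal.ofReal_mul (Real.exp_pos _).le]
  rw [lintegral_mul_const _ (by fun_prop),
    lintegral_exp_inner_mul_inner_stdGaussian (hle.trans_lt hc),
    ← ENNReal.ofReal_mul (by positivity), ← ENNReal.ofReal_one, one_div_mul_eq_div,
    Real.exp_half, Real.exp_log (by linarith)]
  refine ENNReal.ofReal_le_ofReal ?_
  rw [inv_mul_le_one₀ (Real.sqrt_pos.2 (by linarith))]
  exact Real.sqrt_le_sqrt (by linarith)

theorem integral_productExponent_uniformBall (c : ℝ) (w u : E × F) {r : ℝ} (hr : 0 < r) :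
    ∫ θ, productExponent c w θ ∂(uniformBall u r) = productExponent c w u := by
  have := isProbabilityMeasure_uniformBall u hr
  have := isProbabilityMeasure_uniformBall u.1 hr
  have := isProbabilityMeasure_uniformBall u.2 hr
  simp only [productExponent]
  rw [integral_add (integrable_uniformBall (by fun_prop) u hr) (integrable_const _),
    integral_const, probReal_univ, one_smul, uniformBall_prod u.1 u.2 hr]
  simp_rw [real_inner_comm w.1, real_inner_comm w.2]
  rw [integral_prod_mul (fun θ : E => c * inner ℝ w.1 θ) (fun θ : F => inner ℝ w.2 θ),
    integral_const_mul, integral_inner_uniformBall _ _ hr, integral_inner_uniformBall _ _ hr]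

end Exponent

variable {E F : Type*}
  [NormedAddCommGroup E] [InnerProductSpace ℝ E] [FiniteDimensional ℝ E]
  [MeasurableSpace E] [BorelSpace E]
  [NormedAddCommGroup F] [InnerProductSpace ℝ F] [FiniteDimensional ℝ F]
  [MeasurableSpace F] [BorelSpace F]
  {ι : Type*} [Fintype ι]

theorem measure_exists_lt_sum_productExponent_le {c δ : ℝ} (hδ : 0 < δ)
    (hc : c ^ 2 * (81 / 16) < 1) :
    Measure.pi (fun _ : ι => (stdGaussian E).prod (stdGaussian F))
      {w | ∃ u, ‖u‖ ≤ 1 ∧ (Module.finrank ℝ E + Module.finrank ℝ F : ℝ) * Real.log 3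
        + Real.log (1 / δ) < ∑ j, productExponent c (w j) u} ≤ ENNReal.ofReal δ := by
  have h := measure_pi_exists_lt_sum_integral_uniformBall_le (ι := ι)
    ((stdGaussian E).prod (stdGaussian F)) (r := 1 / 2) (R := 1) (by norm_num) zero_le_one hδ
    (continuous_productExponent c).measurable
    (fun w => (continuous_productExponent c).comp (Continuous.prodMk_right w))
    fun θ hθ => lintegral_exp_productExponent_le_one hc (hθ.trans (by norm_num))
  simp_rw [integral_productExponent_uniformBall c _ _ (one_half_pos (α := ℝ)),
    Module.finrank_prod] at h
  norm_num at h ⊢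
  exact h

theorem lt_mul_add_mul_log_one_sub {q T A S : ℝ} (hq : 0 < q) (hq₂ : q ≤ 2) (hT : 0 < T)
    (hA : A ≤ 1 / 2 * (q * T)) (hS : 4 * √T * √(q * T) < S) :
    A < 2 / 9 * √q * S + 1 / 2 * (T * Real.log (1 - q / 4)) := by
  have hlog : -(2 * (q / 4)) ≤ Real.log (1 - q / 4) :=
    neg_two_mul_le_log_one_sub (by positivity) (by linarith)
  calc A ≤ 1 / 2 * (q * T) := hA
    _ < 8 / 9 * (q * T) - 1 / 4 * (q * T) := by linarith [mul_pos hq hT]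
    _ = 2 / 9 * √q * (4 * √T * √(q * T)) + 1 / 2 * (T * -(2 * (q / 4))) := by
        rw [Real.sqrt_mul hq.le]
        linear_combination (-8 / 9 * √q ^ 2) * Real.sq_sqrt hT.le
          - 8 / 9 * T * Real.sq_sqrt hq.le
    _ ≤ 2 / 9 * √q * S + 1 / 2 * (T * Real.log (1 - q / 4)) := by gcongr

omit [FiniteDimensional ℝ E] [MeasurableSpace E] [BorelSpace E] [FiniteDimensional ℝ F]
  [MeasurableSpace F] [BorelSpace F] in
theorem exists_norm_le_one_lt_sum_inner_mul_inner {B : ℝ} {w : ι → E × F} {u : E} {v : F}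
    (h : B * ‖u‖ * ‖v‖ < |∑ j, inner ℝ u (w j).1 * inner ℝ v (w j).2|) :
    ∃ z : E × F, ‖z‖ ≤ 1 ∧ B < ∑ j, inner ℝ z.1 (w j).1 * inner ℝ z.2 (w j).2 := by
  have hu : u ≠ 0 := by rintro rfl; simp at h
  have hv : v ≠ 0 := by rintro rfl; simp at h
  obtain ⟨ε, hε, habs⟩ : ∃ ε : ℝ, |ε| = 1 ∧ |∑ j, inner ℝ u (w j).1 * inner ℝ v (w j).2|
      = ε * ∑ j, inner ℝ u (w j).1 * inner ℝ v (w j).2 := by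
    rcases abs_choice (∑ j, inner ℝ u (w j).1 * inner ℝ v (w j).2) with h | h
    · exact ⟨1, by simp, by rw [h, one_mul]⟩
    · exact ⟨-1, by simp, by rw [h, neg_one_mul]⟩
  refine ⟨(ε • ‖u‖⁻¹ • u, ‖v‖⁻¹ • v), max_le ?_ (norm_smul_inv_norm hv).le, ?_⟩
  · rw [norm_smul, Real.norm_eq_abs, hε, one_mul]
    exact (norm_smul_inv_norm hu).le
  · calc B = B * ‖u‖ * ‖v‖ / (‖u‖ * ‖v‖) := by field_simp
      _ < (ε * ∑ j, inner ℝ u (w j).1 * inner ℝ v (w j).2) / (‖u‖ * ‖v‖) :=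
        div_lt_div_of_pos_right (h.trans_eq habs) (by positivity)
      _ = _ := by
        rw [Finset.mul_sum, Finset.sum_div]
        refine Finset.sum_congr rfl fun j _ => ?_
        simp only [real_inner_smul_left]
        field_simp

theorem measure_exists_lt_abs_sum_inner_mul_inner_le {δ : ℝ} (hδ : 0 < δ) (hδ₃ : δ ≤ 1 / 3)
    (hEF : 2 ≤ Module.finrank ℝ E + Module.finrank ℝ F)
    (hι : 2 * (Module.finrank ℝ E + Module.finrank ℝ F : ℝ) * Real.log (1 / δ)
      ≤ Fintype.card ι) :
    Measure.pi (fun _ : ι => (stdGaussian E).prod (stdGaussian F))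
      {w | ∃ u v, 4 * √(Fintype.card ι)
          * √((Module.finrank ℝ E + Module.finrank ℝ F : ℝ) * Real.log (9 / δ)) * ‖u‖ * ‖v‖
        < |∑ j, inner ℝ u (w j).1 * inner ℝ v (w j).2|} ≤ ENNReal.ofReal δ := by
  set N : ℝ := (Module.finrank ℝ E : ℝ) + Module.finrank ℝ F with hN_def
  set T : ℝ := (Fintype.card ι : ℝ)
  rw [log_nine_div hδ]
  set L := Real.log 3
  set D := Real.log (1 / δ)
  have hN : 2 ≤ N := by rw [hN_def]; exact_mod_cast hEF
  have hL : 1 ≤ L := one_le_log_three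
  have hLD : L ≤ D := Real.log_le_log (by norm_num) (by rw [le_div_iff₀ hδ]; linarith)
  have hT : 0 < T := by nlinarith
  obtain ⟨q, hqT⟩ : ∃ q, q * T = N * (2 * L + D) := ⟨_, div_mul_cancel₀ _ hT.ne'⟩
  have hq : 0 < q := pos_of_mul_pos_left (by rw [hqT]; nlinarith) hT.le
  have hq₂ : q ≤ 3 / 2 := le_of_mul_le_mul_right (by rw [hqT]; nlinarith) hT
  have hsq : (2 / 9 * √q) ^ 2 * (81 / 16) = q / 4 := by
    rw [mul_pow, Real.sq_sqrt hq.le]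
    ring
  refine (measure_mono ?_).trans (measure_exists_lt_sum_productExponent_le
    (c := 2 / 9 * √q) hδ (by linarith))
  rintro w ⟨u, v, huv⟩
  obtain ⟨z, hz, hlt⟩ := exists_norm_le_one_lt_sum_inner_mul_inner huv
  refine ⟨z, hz, ?_⟩
  simp only [productExponent, Finset.sum_add_distrib, mul_assoc, ← Finset.mul_sum,
    Finset.sum_const, Finset.card_univ, nsmul_eq_mul, hsq]
  rw [← mul_assoc (2 / 9)]
  rw [← hqT] at hlt
  have hA : N * L + D ≤ 1 / 2 * (q * T) := by
    rw [hqT]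
    nlinarith
  exact lt_mul_add_mul_log_one_sub hq (by linarith) hT hA hlt

end ProductOfGaussians

section FrobeniusConcentration

variable {E : Type*} [NormedAddCommGroup E] [InnerProductSpace ℝ E] [FiniteDimensional ℝ E]
  [MeasurableSpace E] [BorelSpace E] {ι : Type*} [Fintype ι]

theorem lintegral_exp_inner_sum_smul_stdGaussian (c : ι → ℝ) (z : E) :
    ∫⁻ g, ENNReal.ofReal (Real.exp (inner ℝ z (∑ j, c j • g j)))
        ∂(Measure.pi fun _ : ι => stdGaussian E)
      = ENNReal.ofReal (Real.exp ((∑ j, c j ^ 2) * ‖z‖ ^ 2 / 2)) := by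
  simp_rw [inner_sum, real_inner_smul_right, ← real_inner_smul_left]
  rw [lintegral_exp_sum_pi _ (φ := fun j x => inner ℝ (c j • z) x) fun j => by fun_prop]
  simp_rw [lintegral_exp_inner_stdGaussian]
  rw [← ENNReal.ofReal_prod_of_nonneg fun _ _ => (Real.exp_pos _).le, ← Real.exp_sum]
  simp only [norm_smul, mul_pow, Real.norm_eq_abs, sq_abs, Finset.sum_mul, Finset.sum_div]

-- `exp (a‖h‖²)` is the average of `exp (√(2a) ⟪z, h⟫)` over a standard Gaussian `z`.
theorem lintegral_exp_mul_norm_sum_smul_sq_stdGaussian {a : ℝ} (ha : 0 ≤ a) {c : ι → ℝ}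
    (hc : a * ∑ j, c j ^ 2 < 1 / 2) :
    ∫⁻ g, ENNReal.ofReal (Real.exp (a * ‖∑ j, c j • g j‖ ^ 2))
        ∂(Measure.pi fun _ : ι => stdGaussian E)
      = ENNReal.ofReal ((√(1 - 2 * (a * ∑ j, c j ^ 2)))⁻¹ ^ Module.finrank ℝ E) := by
  have hsqrt : √(2 * a) ^ 2 = 2 * a := Real.sq_sqrt (by positivity)
  have hlinear (h : E) : ENNReal.ofReal (Real.exp (a * ‖h‖ ^ 2))
      = ∫⁻ z, ENNReal.ofReal (Real.exp (inner ℝ (√(2 * a) • z) h)) ∂(stdGaussian E) := by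
    simp_rw [real_inner_smul_left, ← real_inner_smul_right, real_inner_comm (√(2 * a) • h)]
    rw [lintegral_exp_inner_stdGaussian, norm_smul, mul_pow, Real.norm_eq_abs, sq_abs, hsqrt]
    ring_nf
  simp_rw [hlinear]
  rw [lintegral_lintegral_swap (by fun_prop)]
  simp_rw [lintegral_exp_inner_sum_smul_stdGaussian, norm_smul, mul_pow, Real.norm_eq_abs, sq_abs,
    hsqrt]
  have hquad := lintegral_exp_quadratic_stdGaussian (c := 0) (0 : E) hc (by simpa using hc)
  have hpos : 1 - 2 * (a * ∑ j, c j ^ 2) ≠ 0 := by linarith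
  simp only [zero_mul, sub_zero, mul_zero, add_zero, div_self hpos, Real.sqrt_one,
    one_mul] at hquad
  rw [← hquad]
  congr! 4
  ring

theorem lintegral_exp_sum_mul_le_of_forall_le {Ω α : Type*} [MeasurableSpace Ω] [Fintype α]
    {P : Measure Ω} {p : α → ℝ} (hp : ∀ b, 0 ≤ p b) (hp₁ : ∑ b, p b = 1) {f : α → Ω → ℝ}
    (hf : ∀ b, Measurable (f b)) {C : ENNReal}
    (hC : ∀ b, ∫⁻ ω, ENNReal.ofReal (Real.exp (f b ω)) ∂P ≤ C) :
    ∫⁻ ω, ENNReal.ofReal (Real.exp (∑ b, p b * f b ω)) ∂P ≤ C := by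
  have hjensen (ω) : ENNReal.ofReal (Real.exp (∑ b, p b * f b ω))
      ≤ ∑ b, ENNReal.ofReal (p b) * ENNReal.ofReal (Real.exp (f b ω)) := by
    simp_rw [← ENNReal.ofReal_mul (hp _)]
    rw [← ENNReal.ofReal_sum_of_nonneg fun b _ => mul_nonneg (hp b) (Real.exp_pos _).le]
    exact ENNReal.ofReal_le_ofReal
      (convexOn_exp.map_sum_le (fun b _ => hp b) hp₁ fun _ _ => Set.mem_univ _)
  calc _ ≤ ∫⁻ ω, ∑ b, ENNReal.ofReal (p b) * ENNReal.ofReal (Real.exp (f b ω)) ∂P :=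
        lintegral_mono hjensen
    _ = ∑ b, ENNReal.ofReal (p b) * ∫⁻ ω, ENNReal.ofReal (Real.exp (f b ω)) ∂P := by
        rw [lintegral_finsetSum _ fun b _ => by fun_prop]
        exact Finset.sum_congr rfl fun b _ => lintegral_const_mul _ (by fun_prop)
    _ ≤ ∑ b, ENNReal.ofReal (p b) * C := by gcongr with b; exact hC b
    _ = C := by
        rw [← Finset.sum_mul, ← ENNReal.ofReal_sum_of_nonneg fun b _ => hp b, hp₁,
          ENNReal.ofReal_one, one_mul]

theorem lintegral_exp_mul_sum_norm_sq_div_le {α : Type*} [Fintype α] (M : ι → α → ℝ) {a : ℝ}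
    (ha : 0 ≤ a) (ha' : a < 1 / 2) (hM : 0 < ∑ b, ∑ j, M j b ^ 2) :
    ∫⁻ g, ENNReal.ofReal (Real.exp
          (a * ((∑ b, ‖∑ j, M j b • g j‖ ^ 2) / ∑ b, ∑ j, M j b ^ 2)))
        ∂(Measure.pi fun _ : ι => stdGaussian E)
      ≤ ENNReal.ofReal ((√(1 - 2 * a))⁻¹ ^ Module.finrank ℝ E) := by
  set w : α → ℝ := fun b => ∑ j, M j b ^ 2
  set S := ∑ b, w b
  have hw (b) : 0 ≤ w b := Finset.sum_nonneg fun _ _ => sq_nonneg _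
  have hM₀ {b : α} (hb : w b = 0) (j : ι) : M j b = 0 :=
    pow_eq_zero_iff two_ne_zero |>.1 ((Finset.sum_eq_zero_iff_of_nonneg
      fun j _ => sq_nonneg (M j b)).1 hb j (Finset.mem_univ j))
  have hsplit (g : ι → E) : a * ((∑ b, ‖∑ j, M j b • g j‖ ^ 2) / S)
      = ∑ b, w b / S * (a / w b * ‖∑ j, M j b • g j‖ ^ 2) := by
    rw [Finset.sum_div, Finset.mul_sum]
    refine Finset.sum_congr rfl fun b _ => ?_
    rcases eq_or_ne (w b) 0 with hb | hb
    · simp [hM₀ hb]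
    · field_simp
  simp_rw [hsplit]
  refine lintegral_exp_sum_mul_le_of_forall_le (fun b => div_nonneg (hw b) hM.le)
    (by rw [← Finset.sum_div, div_self hM.ne']) (fun b => by fun_prop) fun b => ?_
  have hle : a / w b * w b ≤ a := by
    rw [div_mul_eq_mul_div]
    exact div_le_of_le_mul₀ (hw b) ha le_rfl
  rw [lintegral_exp_mul_norm_sum_smul_sq_stdGaussian (div_nonneg ha (hw b)) (by linarith)]
  have : 0 < √(1 - 2 * a) := Real.sqrt_pos.2 (by linarith)
  gcongr

theorem inv_pow_le_exp_of_sqrt_div {d : ℕ} (hd : 0 < d) {s : ℝ} (hs : 0 ≤ s) :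
    (√(d : ℝ) / (√(d : ℝ) + s))⁻¹ ^ d ≤ Real.exp (s * √(d : ℝ)) := by
  have hd' : 0 < √(d : ℝ) := by positivity
  calc (√(d : ℝ) / (√(d : ℝ) + s))⁻¹ ^ d = (s / √(d : ℝ) + 1) ^ d := by
        rw [inv_div, add_div, div_self hd'.ne', add_comm]
    _ ≤ Real.exp (s / √(d : ℝ)) ^ d := by
        gcongr
        exact Real.add_one_le_exp _
    _ = Real.exp (s * √(d : ℝ)) := by
        rw [← Real.exp_nat_mul]
        congr 1
        nth_rw 1 [← Real.mul_self_sqrt d.cast_nonneg]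
        field_simp

theorem measure_mul_sum_sq_lt_sum_norm_sq_le [Nontrivial E] {α : Type*} [Fintype α]
    (M : ι → α → ℝ) (hM : 0 < ∑ b, ∑ j, M j b ^ 2) {s : ℝ} (hs : 0 ≤ s) :
    Measure.pi (fun _ : ι => stdGaussian E)
        {g | (√(Module.finrank ℝ E) + s) ^ 2 * ∑ b, ∑ j, M j b ^ 2
          < ∑ b, ‖∑ j, M j b • g j‖ ^ 2}
      ≤ ENNReal.ofReal (Real.exp (-s ^ 2 / 2)) := by
  set q := √(Module.finrank ℝ E : ℝ)
  have hd : 0 < Module.finrank ℝ E := Module.finrank_pos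
  have hq : 0 < q := by positivity
  set S := ∑ b, ∑ j, M j b ^ 2
  -- This exponent minimizes the bound below.
  set a := (1 - (q / (q + s)) ^ 2) / 2
  have hratio : q / (q + s) ≤ 1 := div_le_one_of_le₀ (by linarith) (by positivity)
  have ha : 0 ≤ a := div_nonneg (sub_nonneg.2 (pow_le_one₀ (by positivity) hratio)) two_pos.le
  have ha' : a < 1 / 2 := div_lt_div_of_pos_right (sub_lt_self _ (by positivity)) two_pos
  have hsqrt : √(1 - 2 * a) = q / (q + s) := by
    rw [show 1 - 2 * a = (q / (q + s)) ^ 2 by ring, Real.sqrt_sq (by positivity)]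
  have hexp : a * (q + s) ^ 2 = s * q + s ^ 2 / 2 := by
    simp only [a]
    field_simp
    ring
  calc _ ≤ Measure.pi (fun _ : ι => stdGaussian E)
        {g | ENNReal.ofReal (Real.exp (a * (q + s) ^ 2)) ≤ ENNReal.ofReal (Real.exp
          (a * ((∑ b, ‖∑ j, M j b • g j‖ ^ 2) / S)))} := by
        refine measure_mono fun g hg => ?_
        have := (le_div_iff₀ hM).2 (le_of_lt hg)
        exact ENNReal.ofReal_le_ofReal (by gcongr)
    _ ≤ ENNReal.ofReal ((q / (q + s))⁻¹ ^ Module.finrank ℝ E)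
        / ENNReal.ofReal (Real.exp (a * (q + s) ^ 2)) := by
        refine (meas_ge_le_lintegral_div
          (Measurable.aemeasurable (by fun_prop)) (by simp [Real.exp_pos])
          ENNReal.ofReal_ne_top).trans (ENNReal.div_le_div_right ?_ _)
        rw [← hsqrt]
        exact lintegral_exp_mul_sum_norm_sq_div_le M ha ha' hM
    _ ≤ ENNReal.ofReal (Real.exp (-s ^ 2 / 2)) := by
        rw [← ENNReal.ofReal_div_of_pos (Real.exp_pos _)]
        refine ENNReal.ofReal_le_ofReal ((div_le_iff₀ (Real.exp_pos _)).2 ?_)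
        rw [← Real.exp_add, hexp, show -s ^ 2 / 2 + (s * q + s ^ 2 / 2) = s * q by ring]
        exact inv_pow_le_exp_of_sqrt_div hd hs

omit [FiniteDimensional ℝ E] [MeasurableSpace E] [BorelSpace E] in
theorem abs_sum_inner_mul_inner_le {α V : Type*} [Fintype α] [NormedAddCommGroup V]
    [InnerProductSpace ℝ V] (e : OrthonormalBasis α ℝ V) (h : ι → E) (μ : ι → V) (u : E) (v : V) :
    |∑ j, inner ℝ u (h j) * inner ℝ v (μ j)|
      ≤ √(∑ b, ‖∑ j, inner ℝ (e b) (μ j) • h j‖ ^ 2) * ‖u‖ * ‖v‖ := by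
  have hexpand : ∑ j, inner ℝ u (h j) * inner ℝ v (μ j)
      = inner ℝ u (∑ b, inner ℝ v (e b) • ∑ j, inner ℝ (e b) (μ j) • h j) := by
    simp_rw [inner_sum, real_inner_smul_right, inner_sum, real_inner_smul_right, Finset.mul_sum]
    rw [Finset.sum_comm]
    refine Finset.sum_congr rfl fun j _ => ?_
    rw [← e.sum_inner_mul_inner v (μ j), Finset.mul_sum]
    exact Finset.sum_congr rfl fun b _ => by ring
  have hsum : ‖∑ b, inner ℝ v (e b) • ∑ j, inner ℝ (e b) (μ j) • h j‖
      ≤ ‖v‖ * √(∑ b, ‖∑ j, inner ℝ (e b) (μ j) • h j‖ ^ 2) := by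
    refine (norm_sum_le _ _).trans ?_
    simp_rw [norm_smul, Real.norm_eq_abs]
    refine (Real.sum_mul_le_sqrt_mul_sqrt _ _ _).trans_eq ?_
    simp_rw [sq_abs]
    rw [e.sum_sq_inner_left, Real.sqrt_sq (norm_nonneg v)]
  calc _ ≤ ‖u‖ * ‖∑ b, inner ℝ v (e b) • ∑ j, inner ℝ (e b) (μ j) • h j‖ := by
        rw [hexpand]
        exact abs_real_inner_le_norm _ _
    _ ≤ ‖u‖ * (‖v‖ * √(∑ b, ‖∑ j, inner ℝ (e b) (μ j) • h j‖ ^ 2)) := by gcongr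
    _ = _ := by ring

theorem measure_exists_lt_abs_sum_inner_mul_inner_const_le [Nontrivial E] {V : Type*}
    [NormedAddCommGroup V] [InnerProductSpace ℝ V] [FiniteDimensional ℝ V] (μ : ι → V) {s : ℝ}
    (hs : 0 ≤ s) :
    Measure.pi (fun _ : ι => stdGaussian E)
        {g | ∃ u v, (√(Module.finrank ℝ E) + s) * √(∑ j, ‖μ j‖ ^ 2) * ‖u‖ * ‖v‖
          < |∑ j, inner ℝ u (g j) * inner ℝ v (μ j)|}
      ≤ ENNReal.ofReal (Real.exp (-s ^ 2 / 2)) := by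
  set e := stdOrthonormalBasis ℝ V
  have hfrobenius : ∑ b, ∑ j, inner ℝ (e b) (μ j) ^ 2 = ∑ j, ‖μ j‖ ^ 2 := by
    rw [Finset.sum_comm]
    exact Finset.sum_congr rfl fun j _ => e.sum_sq_inner_right (μ j)
  by_cases hμ : ∀ j, μ j = 0
  · simp [hμ]
  have hpos : 0 < ∑ b, ∑ j, inner ℝ (e b) (μ j) ^ 2 := by
    obtain ⟨j, hj⟩ := not_forall.1 hμ
    rw [hfrobenius]
    exact Finset.sum_pos' (fun j _ => sq_nonneg _) ⟨j, Finset.mem_univ j, by positivity⟩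
  refine (measure_mono ?_).trans (measure_mul_sum_sq_lt_sum_norm_sq_le
    (fun j b => inner ℝ (e b) (μ j)) hpos hs)
  rintro g ⟨u, v, hlt⟩
  by_contra hle
  refine hlt.not_ge ((abs_sum_inner_mul_inner_le e g μ u v).trans ?_)
  gcongr
  rw [← Real.sqrt_sq (show 0 ≤ √(Module.finrank ℝ E : ℝ) + s by positivity), ← hfrobenius,
    ← Real.sqrt_mul (by positivity)]
  exact Real.sqrt_le_sqrt (not_lt.1 hle)

end FrobeniusConcentration

section TypicalSamples

variable {E F ι : Type*} [Fintype ι]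
  [NormedAddCommGroup E] [InnerProductSpace ℝ E]
  [NormedAddCommGroup F] [InnerProductSpace ℝ F]

/-- A sample of pairs (feature, noise) is well conditioned with constants `c` and `K` if the
quadratic form `∑ ⟪u, xⱼ⟫²` of its features is at least `c‖u‖²` and the bilinear form
`∑ ⟪u, xⱼ⟫⟪v, ηⱼ⟫` of its feature-noise correlation is at most `K‖u‖‖v‖`. On such samples the
error of the least squares estimate is at most `K / c`. -/
structure IsWellConditioned (c K : ℝ) (w : ι → E × F) : Prop where
  gram_lower (u : E) : c * ‖u‖ ^ 2 ≤ ∑ j, inner ℝ u (w j).1 ^ 2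
  cross_upper (u : E) (v : F) : |∑ j, inner ℝ u (w j).1 * inner ℝ v (w j).2| ≤ K * ‖u‖ * ‖v‖

/-- A sample of pairs of centred, normalized features and noises is typical for the means `μ` at
confidence level `δ` if the four quadratic and bilinear forms through which it enters the least
squares error have the size expected of standard Gaussian vectors. -/
structure IsTypicalSample (μ : ι → E) (δ : ℝ) (w : ι → E × F) : Prop where
  gram_lower (u : E) : Fintype.card ι / 4 * ‖u‖ ^ 2 ≤ ∑ j, inner ℝ u (w j).1 ^ 2
  feature_mean_upper (u v : E) : |∑ j, inner ℝ u (w j).1 * inner ℝ v (μ j)|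
    ≤ (√(Module.finrank ℝ E) + √(2 * Real.log (2 / δ))) * √(∑ j, ‖μ j‖ ^ 2) * ‖u‖ * ‖v‖
  noise_mean_upper (v : F) (u : E) : |∑ j, inner ℝ v (w j).2 * inner ℝ u (μ j)|
    ≤ (√(Module.finrank ℝ F) + √(2 * Real.log (2 / δ))) * √(∑ j, ‖μ j‖ ^ 2) * ‖v‖ * ‖u‖
  feature_noise_upper (u : E) (v : F) : |∑ j, inner ℝ u (w j).1 * inner ℝ v (w j).2|
    ≤ 4 * √(Fintype.card ι)
      * √((Module.finrank ℝ E + Module.finrank ℝ F : ℝ) * Real.log (9 / δ)) * ‖u‖ * ‖v‖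

theorem isClosed_isWellConditioned (c K : ℝ) :
    IsClosed {w : ι → E × F | IsWellConditioned c K w} := by
  have hinter : {w : ι → E × F | IsWellConditioned c K w}
      = (⋂ u, {w | c * ‖u‖ ^ 2 ≤ ∑ j, inner ℝ u (w j).1 ^ 2})
        ∩ ⋂ u, ⋂ v, {w | |∑ j, inner ℝ u (w j).1 * inner ℝ v (w j).2| ≤ K * ‖u‖ * ‖v‖} := by
    ext w
    simp only [Set.mem_inter_iff, Set.mem_iInter]
    exact ⟨fun h => ⟨h.gram_lower, h.cross_upper⟩, fun h => ⟨h.1, h.2⟩⟩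
  rw [hinter]
  exact (isClosed_iInter fun u => isClosed_le (by fun_prop) (by fun_prop)).inter
    (isClosed_iInter fun u => isClosed_iInter fun v => isClosed_le (by fun_prop) (by fun_prop))

theorem measure_exists_sqrt_log_lt_abs_sum_inner_mul_inner_const_le [FiniteDimensional ℝ E]
    [MeasurableSpace E] [BorelSpace E] [Nontrivial E] {V : Type*} [NormedAddCommGroup V]
    [InnerProductSpace ℝ V] [FiniteDimensional ℝ V] (μ : ι → V) {ε : ℝ} (hε : 0 < ε)
    (hε₁ : ε ≤ 1) :
    Measure.pi (fun _ : ι => stdGaussian E)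
        {g | ∃ u v, (√(Module.finrank ℝ E) + √(2 * Real.log (1 / ε))) * √(∑ j, ‖μ j‖ ^ 2)
          * ‖u‖ * ‖v‖ < |∑ j, inner ℝ u (g j) * inner ℝ v (μ j)|}
      ≤ ENNReal.ofReal ε := by
  have hlog : 0 ≤ Real.log (1 / ε) := Real.log_nonneg (one_le_one_div hε hε₁)
  have hexp : Real.exp (-√(2 * Real.log (1 / ε)) ^ 2 / 2) = ε := by
    rw [Real.sq_sqrt (by positivity), neg_div, mul_div_cancel_left₀ _ two_ne_zero, one_div,
      Real.log_inv, neg_neg, Real.exp_log hε]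
  simpa only [hexp] using measure_exists_lt_abs_sum_inner_mul_inner_const_le (E := E) μ
    (Real.sqrt_nonneg (2 * Real.log (1 / ε)))

theorem measure_not_isTypicalSample_le [FiniteDimensional ℝ E] [MeasurableSpace E] [BorelSpace E]
    [Nontrivial E] [FiniteDimensional ℝ F] [MeasurableSpace F] [BorelSpace F] [Nontrivial F]
    (μ : ι → E) {δ : ℝ} (hδ : 0 < δ) (hδ₃ : δ ≤ 1 / 3)
    (hι : 8 * (Module.finrank ℝ E : ℝ) + 8 * Real.log (1 / δ) ≤ Fintype.card ι)
    (hι' : 2 * (Module.finrank ℝ E + Module.finrank ℝ F : ℝ) * Real.log (1 / δ)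
      ≤ Fintype.card ι) :
    Measure.pi (fun _ : ι => (stdGaussian E).prod (stdGaussian F))
        {w | ¬ IsTypicalSample μ δ w} ≤ ENNReal.ofReal (3 * δ) := by
  set Q := Measure.pi fun _ : ι => (stdGaussian E).prod (stdGaussian F)
  have hfst : MeasurePreserving (fun (w : ι → E × F) j => (w j).1) Q
      (Measure.pi fun _ => stdGaussian E) :=
    measurePreserving_pi _ _ fun _ => measurePreserving_fst
  have hsnd : MeasurePreserving (fun (w : ι → E × F) j => (w j).2) Q
      (Measure.pi fun _ => stdGaussian F) :=
    measurePreserving_pi _ _ fun _ => measurePreserving_snd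
  have hgram := (hfst.measure_preimage_le _).trans
    (measure_exists_sum_inner_sq_lt_le (E := E) (ι := ι) hδ (by linarith) hι)
  have hfeature := (hfst.measure_preimage_le _).trans
    (measure_exists_sqrt_log_lt_abs_sum_inner_mul_inner_const_le μ (half_pos hδ) (by linarith))
  have hnoise := (hsnd.measure_preimage_le _).trans
    (measure_exists_sqrt_log_lt_abs_sum_inner_mul_inner_const_le μ (half_pos hδ) (by linarith))
  have hcross := measure_exists_lt_abs_sum_inner_mul_inner_le (E := E) (F := F) (ι := ι) hδ hδ₃
    (Nat.add_le_add (Module.finrank_pos (M := E)) (Module.finrank_pos (M := F))) hι'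
  rw [one_div_div] at hfeature hnoise
  rw [show 3 * δ = (δ + δ / 2) + (δ / 2 + δ) by ring, ENNReal.ofReal_add (by positivity)
    (by positivity), ENNReal.ofReal_add hδ.le (by positivity), ENNReal.ofReal_add (by positivity)
    hδ.le]
  refine (measure_mono fun w hw => ?_).trans ((measure_union_le _ _).trans (add_le_add
    ((measure_union_le _ _).trans (add_le_add hgram hfeature))
    ((measure_union_le _ _).trans (add_le_add hnoise hcross))))
  by_contra hgood
  simp only [Set.mem_union, not_or] at hgood
  obtain ⟨⟨hgram, hfeature⟩, hnoise, hcross⟩ := hgood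
  exact hw
    { gram_lower := fun u => not_lt.1 fun h => hgram ⟨u, h⟩
      feature_mean_upper := fun u v => not_lt.1 fun h => hfeature ⟨u, v, h⟩
      noise_mean_upper := fun v u => not_lt.1 fun h => hnoise ⟨v, u, h⟩
      feature_noise_upper := fun u v => not_lt.1 fun h => hcross ⟨u, v, h⟩ }

theorem mul_norm_sq_le_sum_inner_add_smul_sq {g μ : ι → E} {σ T lam : ℝ} (hσ : 0 < σ) (hT : 0 < T)
    {u : E} (hlam : lam * ‖u‖ ^ 2 ≤ ‖u‖ ^ 2 + 4 / (T * σ ^ 2) * ∑ j, inner ℝ u (μ j) ^ 2)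
    (hg : T / 4 * ‖u‖ ^ 2 ≤ ∑ j, inner ℝ u (g j) ^ 2)
    (hgμ : |∑ j, inner ℝ u (g j) * inner ℝ u (μ j)| ≤ T * σ / 16 * ‖u‖ ^ 2) :
    T * σ ^ 2 / 8 * lam * ‖u‖ ^ 2 ≤ ∑ j, inner ℝ u (μ j + σ • g j) ^ 2 := by
  have hμ : 0 ≤ ∑ j, inner ℝ u (μ j) ^ 2 := Finset.sum_nonneg fun j _ => sq_nonneg _
  have hexpand : ∑ j, inner ℝ u (μ j + σ • g j) ^ 2 = ∑ j, inner ℝ u (μ j) ^ 2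
      + 2 * σ * ∑ j, inner ℝ u (g j) * inner ℝ u (μ j) + σ ^ 2 * ∑ j, inner ℝ u (g j) ^ 2 := by
    rw [Finset.mul_sum, Finset.mul_sum, ← Finset.sum_add_distrib, ← Finset.sum_add_distrib]
    refine Finset.sum_congr rfl fun j _ => ?_
    rw [inner_add_right, inner_smul_right]
    ring
  have hcross : -(T * σ ^ 2 / 8 * ‖u‖ ^ 2)
      ≤ 2 * σ * ∑ j, inner ℝ u (g j) * inner ℝ u (μ j) := by
    linear_combination 2 * σ * (abs_le.1 hgμ).1
  calc T * σ ^ 2 / 8 * lam * ‖u‖ ^ 2 = T * σ ^ 2 / 8 * (lam * ‖u‖ ^ 2) := by ring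
    _ ≤ T * σ ^ 2 / 8 * (‖u‖ ^ 2 + 4 / (T * σ ^ 2) * ∑ j, inner ℝ u (μ j) ^ 2) := by gcongr
    _ = T * σ ^ 2 / 8 * ‖u‖ ^ 2 + (∑ j, inner ℝ u (μ j) ^ 2) / 2 := by field_simp; ring
    _ ≤ ∑ j, inner ℝ u (μ j) ^ 2 + 2 * σ * ∑ j, inner ℝ u (g j) * inner ℝ u (μ j)
        + σ ^ 2 * (T / 4 * ‖u‖ ^ 2) := by linarith
    _ ≤ _ := by rw [hexpand]; gcongr

omit [InnerProductSpace ℝ E] in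
theorem sqrt_sum_norm_sq_le [Nonempty ι] {μ : ι → E} {μhat : ℝ} (hμ : ∀ j, ‖μ j‖ ≤ μhat) :
    √(∑ j, ‖μ j‖ ^ 2) ≤ √(Fintype.card ι) * μhat := by
  have hμhat : 0 ≤ μhat := (norm_nonneg _).trans (hμ (Classical.arbitrary ι))
  rw [← Real.sqrt_sq hμhat, ← Real.sqrt_mul (by positivity), ← nsmul_eq_mul]
  gcongr
  exact Finset.sum_le_card_nsmul _ _ _ fun j _ => by gcongr; exact hμ j

theorem mul_sqrt_mul_le_mul_div_sixteen {μhat σ d s T : ℝ} (hμhat : 0 ≤ μhat) (hσ : 0 < σ)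
    (hd : 0 ≤ d) (hT : 0 ≤ T) (h : (16 * μhat * (√(4 * d) + s) / σ) ^ 2 ≤ T) :
    (√d + s) * (√T * μhat) ≤ T * σ / 16 := by
  have hsqrt : 16 * μhat * (√(4 * d) + s) ≤ √T * σ :=
    (div_le_iff₀ hσ).1 (Real.le_sqrt_of_sq_le h)
  have hd4 : √d ≤ √(4 * d) := Real.sqrt_le_sqrt (by linarith)
  calc (√d + s) * (√T * μhat) ≤ (√(4 * d) + s) * (√T * μhat) := by gcongr
    _ = √T / 16 * (16 * μhat * (√(4 * d) + s)) := by ring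
    _ ≤ √T / 16 * (√T * σ) := by gcongr
    _ = T * σ / 16 := by
        nth_rw 3 [← Real.mul_self_sqrt hT]
        ring

namespace IsTypicalSample

variable [Nonempty ι] {μ : ι → E} {δ σx ση μhat : ℝ} {w : ι → E × F}

theorem gram_add_smul_lower (h : IsTypicalSample μ δ w) (hσx : 0 < σx)
    (hμ : ∀ j, ‖μ j‖ ≤ μhat)
    (hι₂ : (16 * μhat * (√(4 * (Module.finrank ℝ E : ℝ)) + √(2 * Real.log (2 / δ))) / σx) ^ 2
      ≤ Fintype.card ι) {lam : ℝ} {u : E}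
    (hlam : lam * ‖u‖ ^ 2
      ≤ ‖u‖ ^ 2 + 4 / (Fintype.card ι * σx ^ 2) * ∑ j, inner ℝ u (μ j) ^ 2) :
    Fintype.card ι * σx ^ 2 / 8 * lam * ‖u‖ ^ 2 ≤ ∑ j, inner ℝ u (μ j + σx • (w j).1) ^ 2 := by
  have hι : 0 < (Fintype.card ι : ℝ) := Nat.cast_pos.2 Fintype.card_pos
  have hμhat : 0 ≤ μhat := (norm_nonneg _).trans (hμ (Classical.arbitrary ι))
  refine mul_norm_sq_le_sum_inner_add_smul_sq hσx hι hlam (h.gram_lower u) ?_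
  calc |∑ j, inner ℝ u (w j).1 * inner ℝ u (μ j)|
      ≤ (√(Module.finrank ℝ E) + √(2 * Real.log (2 / δ))) * √(∑ j, ‖μ j‖ ^ 2) * ‖u‖ * ‖u‖ :=
        h.feature_mean_upper u u
    _ ≤ (√(Module.finrank ℝ E) + √(2 * Real.log (2 / δ))) * (√(Fintype.card ι) * μhat)
          * ‖u‖ * ‖u‖ := by
        gcongr
        exact sqrt_sum_norm_sq_le hμ
    _ ≤ Fintype.card ι * σx / 16 * ‖u‖ * ‖u‖ := by
        gcongr
        exact mul_sqrt_mul_le_mul_div_sixteen hμhat hσx (by positivity) hι.le hι₂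
    _ = Fintype.card ι * σx / 16 * ‖u‖ ^ 2 := by ring

theorem abs_sum_inner_add_smul_mul_inner_smul_le (h : IsTypicalSample μ δ w) (hσx : 0 ≤ σx)
    (hση : 0 ≤ ση) (hδ : 0 < δ) (hδ₂ : δ ≤ 2) (hμ : ∀ j, ‖μ j‖ ≤ μhat) (u : E) (v : F) :
    |∑ j, inner ℝ u (μ j + σx • (w j).1) * inner ℝ v (ση • (w j).2)|
      ≤ √(Fintype.card ι) * constC1 (Module.finrank ℝ E) (Module.finrank ℝ F) σx ση μhat δ / 8
        * ‖u‖ * ‖v‖ := by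
  have hexpand : ∑ j, inner ℝ u (μ j + σx • (w j).1) * inner ℝ v (ση • (w j).2)
      = ση * (∑ j, inner ℝ v (w j).2 * inner ℝ u (μ j)
        + σx * ∑ j, inner ℝ u (w j).1 * inner ℝ v (w j).2) := by
    rw [Finset.mul_sum, ← Finset.sum_add_distrib, Finset.mul_sum]
    refine Finset.sum_congr rfl fun j _ => ?_
    rw [inner_add_right, inner_smul_right, inner_smul_right]
    ring
  have : 0 ≤ μhat := (norm_nonneg _).trans (hμ (Classical.arbitrary ι))
  have hlog : 0 ≤ Real.log (2 / δ) := Real.log_nonneg ((one_le_div hδ).2 hδ₂)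
  have hs : √(2 * Real.log (2 / δ)) ≤ 2 * √(Real.log (2 / δ)) := by
    rw [Real.sqrt_le_left (by positivity), mul_pow, Real.sq_sqrt hlog]
    linarith
  have hrank : √(Module.finrank ℝ F : ℝ)
      ≤ √(2 * ((Module.finrank ℝ F : ℝ) + Module.finrank ℝ E)) :=
    Real.sqrt_le_sqrt (by linarith [(Module.finrank ℝ E).cast_nonneg (α := ℝ),
      (Module.finrank ℝ F).cast_nonneg (α := ℝ)])
  have hmean := (h.noise_mean_upper v u).trans (mul_le_mul_of_nonneg_right
    (mul_le_mul_of_nonneg_right (mul_le_mul (add_le_add hrank hs) (sqrt_sum_norm_sq_le hμ)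
      (by positivity) (by positivity)) (norm_nonneg v)) (norm_nonneg u))
  have hnoise := h.feature_noise_upper u v
  rw [hexpand, abs_mul, abs_of_nonneg hση]
  calc _ ≤ ση * (|∑ j, inner ℝ v (w j).2 * inner ℝ u (μ j)|
        + σx * |∑ j, inner ℝ u (w j).1 * inner ℝ v (w j).2|) := by
        gcongr
        refine (abs_add_le _ _).trans_eq ?_
        rw [abs_mul, abs_of_nonneg hσx]
    _ ≤ _ := by
        refine (mul_le_mul_of_nonneg_left (add_le_add hmean
          (mul_le_mul_of_nonneg_left hnoise hσx)) hση).trans_eq ?_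
        rw [constC1]
        ring

theorem isWellConditioned (h : IsTypicalSample μ δ w) (hσx : 0 < σx) (hση : 0 ≤ ση) (hδ : 0 < δ)
    (hδ₂ : δ ≤ 2) (hμ : ∀ j, ‖μ j‖ ≤ μhat)
    (hι₂ : (16 * μhat * (√(4 * (Module.finrank ℝ E : ℝ)) + √(2 * Real.log (2 / δ))) / σx) ^ 2
      ≤ Fintype.card ι) {lam : ℝ}
    (hlam : ∀ u, lam * ‖u‖ ^ 2
      ≤ ‖u‖ ^ 2 + 4 / (Fintype.card ι * σx ^ 2) * ∑ j, inner ℝ u (μ j) ^ 2) :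
    IsWellConditioned (Fintype.card ι * σx ^ 2 / 8 * lam)
      (√(Fintype.card ι) * constC1 (Module.finrank ℝ E) (Module.finrank ℝ F) σx ση μhat δ / 8)
      fun j => (μ j + σx • (w j).1, ση • (w j).2) where
  gram_lower u := h.gram_add_smul_lower hσx hμ hι₂ (hlam u)
  cross_upper u v := h.abs_sum_inner_add_smul_mul_inner_smul_le hσx.le hση hδ hδ₂ hμ u v

end IsTypicalSample

theorem measure_not_isWellConditioned_le [FiniteDimensional ℝ E] [MeasurableSpace E] [BorelSpace E]
    [Nontrivial E] [FiniteDimensional ℝ F] [MeasurableSpace F] [BorelSpace F] [Nontrivial F]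
    [Nonempty ι] {μ : ι → E} {σx ση μhat δ : ℝ} (hσx : 0 < σx) (hση : 0 ≤ ση) (hδ : 0 < δ)
    (hδ₃ : δ ≤ 1 / 3) (hμ : ∀ j, ‖μ j‖ ≤ μhat)
    (hι₁ : 8 * (Module.finrank ℝ E : ℝ) + 8 * Real.log (1 / δ) ≤ Fintype.card ι)
    (hι₂ : (16 * μhat * (√(4 * (Module.finrank ℝ E : ℝ)) + √(2 * Real.log (2 / δ))) / σx) ^ 2
      ≤ Fintype.card ι)
    (hι₃ : 2 * (Module.finrank ℝ E + Module.finrank ℝ F : ℝ) * Real.log (1 / δ)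
      ≤ Fintype.card ι) {lam : ℝ}
    (hlam : ∀ u, lam * ‖u‖ ^ 2
      ≤ ‖u‖ ^ 2 + 4 / (Fintype.card ι * σx ^ 2) * ∑ j, inner ℝ u (μ j) ^ 2) :
    Measure.pi (fun _ : ι => (stdGaussian E).prod (stdGaussian F))
        {w | ¬ IsWellConditioned (Fintype.card ι * σx ^ 2 / 8 * lam)
          (√(Fintype.card ι)
            * constC1 (Module.finrank ℝ E) (Module.finrank ℝ F) σx ση μhat δ / 8)
          fun j => (μ j + σx • (w j).1, ση • (w j).2)}
      ≤ ENNReal.ofReal (3 * δ) := by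
  refine (measure_mono fun w hw => ?_).trans (measure_not_isTypicalSample_le μ hδ hδ₃ hι₁ hι₃)
  exact fun h => hw (h.isWellConditioned hσx hση hδ (hδ₃.trans (by norm_num)) hμ hι₂ hlam)

end TypicalSamples

section CoerciveMatrix

variable {m n : Type*} [Fintype m] [Fintype n]

theorem ofLp_dotProduct_ofLp (u v : EuclideanSpace ℝ n) : u.ofLp ⬝ᵥ v.ofLp = inner ℝ u v := by
  rw [EuclideanSpace.inner_eq_star_dotProduct, star_trivial, dotProduct_comm]

theorem l2_opNorm_le_of_abs_dotProduct_mulVec_le [DecidableEq n] (A : Matrix m n ℝ) {K : ℝ}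
    (hK : 0 ≤ K)
    (h : ∀ (u : EuclideanSpace ℝ m) (v : EuclideanSpace ℝ n),
      |u.ofLp ⬝ᵥ (A *ᵥ v.ofLp)| ≤ K * ‖u‖ * ‖v‖) :
    ‖A‖ ≤ K := by
  rw [Matrix.l2_opNorm_def]
  refine ContinuousLinearMap.opNorm_le_of_re_inner_le hK fun v u hv hu => ?_
  have huv := (le_abs_self _).trans (h u v)
  rw [hu, hv, mul_one, mul_one] at huv
  rw [real_inner_comm]
  exact (ofLp_dotProduct_ofLp u (WithLp.toLp 2 (A *ᵥ v.ofLp))).ge.trans huv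

variable {A : Matrix n n ℝ} {c : ℝ}

theorem mul_norm_le_norm_mulVec
    (h : ∀ u : EuclideanSpace ℝ n, c * ‖u‖ ^ 2 ≤ u.ofLp ⬝ᵥ (A *ᵥ u.ofLp))
    (u : EuclideanSpace ℝ n) : c * ‖u‖ ≤ ‖WithLp.toLp 2 (A *ᵥ u.ofLp)‖ := by
  have hsq : c * ‖u‖ * ‖u‖ ≤ ‖WithLp.toLp 2 (A *ᵥ u.ofLp)‖ * ‖u‖ := by
    calc c * ‖u‖ * ‖u‖ = c * ‖u‖ ^ 2 := by ring
      _ ≤ inner ℝ u (WithLp.toLp 2 (A *ᵥ u.ofLp)) :=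
        (h u).trans_eq (ofLp_dotProduct_ofLp u (WithLp.toLp 2 (A *ᵥ u.ofLp)))
      _ ≤ _ := (real_inner_le_norm _ _).trans_eq (mul_comm _ _)
  rcases (norm_nonneg u).eq_or_lt with hu | hu
  · rw [← hu, mul_zero]
    exact norm_nonneg _
  · exact le_of_mul_le_mul_right hsq hu

variable [DecidableEq n]

theorem isUnit_of_mul_norm_sq_le_dotProduct_mulVec (hc : 0 < c)
    (h : ∀ u : EuclideanSpace ℝ n, c * ‖u‖ ^ 2 ≤ u.ofLp ⬝ᵥ (A *ᵥ u.ofLp)) : IsUnit A := by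
  rw [← Matrix.mulVec_injective_iff_isUnit, ← Matrix.coe_mulVecLin, injective_iff_map_eq_zero]
  intro u hu
  have hle := mul_norm_le_norm_mulVec h (WithLp.toLp 2 u)
  rw [Matrix.mulVecLin_apply] at hu
  simp only [hu, WithLp.toLp_zero, norm_zero] at hle
  have hnorm : ‖WithLp.toLp 2 u‖ = 0 :=
    le_antisymm (nonpos_of_mul_nonpos_right hle hc) (norm_nonneg _)
  simpa using hnorm

theorem l2_opNorm_inv_le_of_mul_norm_sq_le_dotProduct_mulVec (hc : 0 < c)
    (h : ∀ u : EuclideanSpace ℝ n, c * ‖u‖ ^ 2 ≤ u.ofLp ⬝ᵥ (A *ᵥ u.ofLp)) : ‖A⁻¹‖ ≤ c⁻¹ := by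
  have hdet := (Matrix.isUnit_iff_isUnit_det A).1 (isUnit_of_mul_norm_sq_le_dotProduct_mulVec hc h)
  rw [Matrix.l2_opNorm_def]
  refine ContinuousLinearMap.opNorm_le_bound _ (inv_nonneg.2 hc.le) fun v => ?_
  have hle := mul_norm_le_norm_mulVec h (WithLp.toLp 2 (A⁻¹ *ᵥ v.ofLp))
  rw [Matrix.mulVec_mulVec, Matrix.mul_nonsing_inv A hdet, Matrix.one_mulVec] at hle
  exact (le_inv_mul_iff₀ hc).2 hle

end CoerciveMatrix

section LeastSquares

open scoped MatrixOrder in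
theorem lambdaMin_mul_norm_sq_le {n : ℕ} (hn : 0 < n) {A : Matrix (Fin n) (Fin n) ℝ}
    (hA : A.PosSemidef) (u : EuclideanSpace ℝ (Fin n)) :
    lambdaMin A * ‖u‖ ^ 2 ≤ u.ofLp ⬝ᵥ (A *ᵥ u.ofLp) := by
  have hle : algebraMap ℝ _ (lambdaMin A) ≤ A :=
    (algebraMap_le_iff_le_spectrum hA.isHermitian).2 fun ν hν => ((lambdaMin_spec hn A hA).2 ν hν).1
  have h := (Matrix.le_iff.1 hle).dotProduct_mulVec_nonneg u.ofLp
  rw [star_trivial, Matrix.sub_mulVec, dotProduct_sub, Algebra.algebraMap_eq_smul_one,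
    Matrix.smul_mulVec, Matrix.one_mulVec, dotProduct_smul, ofLp_dotProduct_ofLp u u,
    real_inner_self_eq_norm_sq, smul_eq_mul] at h
  exact sub_nonneg.1 h

theorem lambdaMin_pos {n : ℕ} (hn : 0 < n) {A : Matrix (Fin n) (Fin n) ℝ} (hA : A.PosDef) :
    0 < lambdaMin A := by
  have hmem := (lambdaMin_spec hn A hA.posSemidef).1
  rw [hA.isHermitian.spectrum_real_eq_range_eigenvalues] at hmem
  obtain ⟨i, hi⟩ := hmem
  exact hi ▸ hA.eigenvalues_pos i

variable {n l : ℕ} (t : ℕ+)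

theorem dotProduct_outerSum_mulVec (a : ℕ+ → EuclideanSpace ℝ (Fin l))
    (b : ℕ+ → EuclideanSpace ℝ (Fin n)) (u : EuclideanSpace ℝ (Fin l))
    (v : EuclideanSpace ℝ (Fin n)) :
    u.ofLp ⬝ᵥ (outerSum a b t *ᵥ v.ofLp)
      = ∑ j : Finset.Icc 1 t, inner ℝ u (a j) * inner ℝ v (b j) := by
  rw [outerSum, Matrix.sum_mulVec, dotProduct_sum, ← Finset.sum_coe_sort]
  refine Finset.sum_congr rfl fun j _ => ?_
  rw [Matrix.vecMulVec_mulVec, dotProduct_smul, ofLp_dotProduct_ofLp, ofLp_dotProduct_ofLp,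
    op_smul_eq_mul, real_inner_comm v]

theorem posDef_one_add_muBar (σx : ℝ) (μ : ℕ+ → EuclideanSpace ℝ (Fin n)) :
    (1 + muBar σx μ t).PosDef := by
  have houter : (outerSum μ μ t).PosSemidef :=
    Matrix.posSemidef_sum _ fun j _ => Matrix.posSemidef_vecMulVec_self_star (μ j).ofLp
  exact Matrix.PosDef.one.add_posSemidef (houter.smul (by positivity))

theorem lambdaMin_one_add_muBar_mul_norm_sq_le (hn : 0 < n) (σx : ℝ)
    (μ : ℕ+ → EuclideanSpace ℝ (Fin n)) (u : EuclideanSpace ℝ (Fin n)) :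
    lambdaMin (1 + muBar σx μ t) * ‖u‖ ^ 2
      ≤ ‖u‖ ^ 2 + 4 / (((t : ℕ) : ℝ) * σx ^ 2) * ∑ j : Finset.Icc 1 t, inner ℝ u (μ j) ^ 2 := by
  refine (lambdaMin_mul_norm_sq_le hn (posDef_one_add_muBar t σx μ).posSemidef u).trans_eq ?_
  rw [muBar, Matrix.add_mulVec, Matrix.one_mulVec, dotProduct_add, Matrix.smul_mulVec,
    dotProduct_smul, dotProduct_outerSum_mulVec, ofLp_dotProduct_ofLp,
    real_inner_self_eq_norm_sq, smul_eq_mul]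
  simp only [← sq]

variable {t} {Θ : Matrix (Fin l) (Fin n) ℝ} {x : ℕ+ → EuclideanSpace ℝ (Fin n)}
  {η y : ℕ+ → EuclideanSpace ℝ (Fin l)}

theorem lsEstimate_sub_eq (hy : ∀ j, y j = WithLp.toLp 2 (Θ *ᵥ (x j).ofLp) + η j)
    (hU : IsUnit (outerSum x x t)) :
    lsEstimate x y t - Θ = outerSum η x t * (outerSum x x t)⁻¹ := by
  have houter : outerSum y x t = Θ * outerSum x x t + outerSum η x t := by
    rw [outerSum, outerSum, outerSum, Matrix.mul_sum, ← Finset.sum_add_distrib]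
    refine Finset.sum_congr rfl fun j _ => ?_
    rw [Matrix.mul_vecMulVec, ← Matrix.add_vecMulVec, hy, WithLp.ofLp_add]
  rw [lsEstimate, houter, Matrix.add_mul, Matrix.mul_assoc,
    Matrix.mul_nonsing_inv _ ((Matrix.isUnit_iff_isUnit_det _).1 hU), Matrix.mul_one,
    add_sub_cancel_left]

namespace IsWellConditioned

variable {c K : ℝ}

theorem mul_norm_sq_le_dotProduct_outerSum_mulVec
    (h : IsWellConditioned c K fun j : Finset.Icc 1 t => (x j, η j))
    (u : EuclideanSpace ℝ (Fin n)) :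
    c * ‖u‖ ^ 2 ≤ u.ofLp ⬝ᵥ (outerSum x x t *ᵥ u.ofLp) := by
  rw [dotProduct_outerSum_mulVec]
  simpa only [← sq] using h.gram_lower u

theorem isUnit_outerSum (h : IsWellConditioned c K fun j : Finset.Icc 1 t => (x j, η j))
    (hc : 0 < c) : IsUnit (outerSum x x t) :=
  isUnit_of_mul_norm_sq_le_dotProduct_mulVec hc h.mul_norm_sq_le_dotProduct_outerSum_mulVec

theorem norm_lsEstimate_sub_le (h : IsWellConditioned c K fun j : Finset.Icc 1 t => (x j, η j))
    (hc : 0 < c) (hK : 0 ≤ K) (hy : ∀ j, y j = WithLp.toLp 2 (Θ *ᵥ (x j).ofLp) + η j) :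
    ‖lsEstimate x y t - Θ‖ ≤ K / c := by
  have hinv : ‖(outerSum x x t)⁻¹‖ ≤ c⁻¹ :=
    l2_opNorm_inv_le_of_mul_norm_sq_le_dotProduct_mulVec hc
      h.mul_norm_sq_le_dotProduct_outerSum_mulVec
  have hcross : ‖outerSum η x t‖ ≤ K :=
    l2_opNorm_le_of_abs_dotProduct_mulVec_le _ hK fun v u => by
      rw [dotProduct_outerSum_mulVec, mul_right_comm]
      simpa only [mul_comm (inner ℝ v _)] using h.cross_upper u v
  rw [lsEstimate_sub_eq hy (h.isUnit_outerSum hc), div_eq_mul_inv]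
  exact (Matrix.l2_opNorm_mul _ _).trans (mul_le_mul hcross hinv (norm_nonneg _) hK)

end IsWellConditioned

end LeastSquares

section GaussianSample

open scoped MatrixOrder in
theorem multivariateGaussian_sq_smul_one {n : ℕ} (μ : EuclideanSpace ℝ (Fin n)) {σ : ℝ}
    (hσ : 0 ≤ σ) :
    multivariateGaussian μ (σ ^ 2 • (1 : Matrix (Fin n) (Fin n) ℝ))
      = (stdGaussian (EuclideanSpace ℝ (Fin n))).map fun g => μ + σ • g := by
  have hsqrt : CFC.sqrt (σ ^ 2 • (1 : Matrix (Fin n) (Fin n) ℝ)) = σ • 1 :=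
    CFC.sqrt_unique (by rw [smul_mul_smul_comm, one_mul, sq]) (smul_nonneg hσ zero_le_one)
  rw [multivariateGaussian, hsqrt]
  congr 1
  ext g
  simp

variable {Ω ι : Type*} [MeasurableSpace Ω] {P : Measure Ω} [IsProbabilityMeasure P] [Fintype ι]

theorem ofReal_one_sub_le_measure_preimage {α β : Type*} [MeasurableSpace α] [MeasurableSpace β]
    {ν : Measure β} {f : β → α} (hf : Measurable f) {X : Ω → α} (hX : HasLaw X (ν.map f) P)
    {S : Set α} (hS : MeasurableSet S) {ε : ℝ} (hε : 0 ≤ ε)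
    (hν : ν (f ⁻¹' Sᶜ) ≤ ENNReal.ofReal ε) :
    ENNReal.ofReal (1 - ε) ≤ P (X ⁻¹' S) := by
  have hcompl : P (X ⁻¹' Sᶜ) ≤ ENNReal.ofReal ε := by
    rwa [← Measure.map_apply_of_aemeasurable hX.aemeasurable hS.compl, hX.map_eq,
      Measure.map_apply hf hS.compl]
  have hone : 1 ≤ P (X ⁻¹' S) + P (X ⁻¹' Sᶜ) := by
    rw [← measure_univ (μ := P), ← Set.union_compl_self (X ⁻¹' S), ← Set.preimage_compl]
    exact measure_union_le _ _
  rw [ENNReal.ofReal_sub _ hε, ENNReal.ofReal_one]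
  exact tsub_le_iff_right.2 (hone.trans (by gcongr))

variable {n l : ℕ} {σx ση μhat δ : ℝ} {μ : ι → EuclideanSpace ℝ (Fin n)}
  {x : ι → Ω → EuclideanSpace ℝ (Fin n)} {η : ι → Ω → EuclideanSpace ℝ (Fin l)}

theorem hasLaw_pi_gaussian (hσx : 0 ≤ σx) (hση : 0 ≤ ση)
    (hx : ∀ j, HasLaw (x j)
      (multivariateGaussian (μ j) (σx ^ 2 • (1 : Matrix (Fin n) (Fin n) ℝ))) P)
    (hη : ∀ j, HasLaw (η j)
      (multivariateGaussian 0 (ση ^ 2 • (1 : Matrix (Fin l) (Fin l) ℝ))) P)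
    (hindep : iIndepFun (fun j ω => (x j ω, η j ω)) P)
    (hindep_pair : ∀ j, IndepFun (x j) (η j) P) :
    HasLaw (fun ω j => (x j ω, η j ω))
      ((Measure.pi fun _ : ι => (stdGaussian (EuclideanSpace ℝ (Fin n))).prod
        (stdGaussian (EuclideanSpace ℝ (Fin l)))).map
          fun w j => (μ j + σx • (w j).1, ση • (w j).2)) P := by
  convert hindep.hasLaw_pi fun j => (hindep_pair j).hasLaw_prod (hx j) (hη j) using 1
  rw [Measure.pi_map_pi (f := fun j (p : EuclideanSpace ℝ (Fin n) × EuclideanSpace ℝ (Fin l)) =>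
    (μ j + σx • p.1, ση • p.2)) fun j => Measurable.aemeasurable (by fun_prop)]
  congr 1
  ext1 j
  rw [multivariateGaussian_sq_smul_one _ hσx, multivariateGaussian_sq_smul_one _ hση,
    Measure.map_prod_map _ _ (by fun_prop) (by fun_prop)]
  simp only [zero_add]
  rfl

theorem ofReal_le_measure_isWellConditioned [Nonempty ι] (hn : 0 < n) (hl : 0 < l)
    (hσx : 0 < σx) (hση : 0 ≤ ση) (hμ : ∀ j, ‖μ j‖ ≤ μhat)
    (hx : ∀ j, HasLaw (x j)
      (multivariateGaussian (μ j) (σx ^ 2 • (1 : Matrix (Fin n) (Fin n) ℝ))) P)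
    (hη : ∀ j, HasLaw (η j)
      (multivariateGaussian 0 (ση ^ 2 • (1 : Matrix (Fin l) (Fin l) ℝ))) P)
    (hindep : iIndepFun (fun j ω => (x j ω, η j ω)) P)
    (hindep_pair : ∀ j, IndepFun (x j) (η j) P)
    (hδ : 0 < δ) (hδ₃ : δ ≤ 1 / 3)
    (hι₁ : 8 * (n : ℝ) + 8 * Real.log (1 / δ) ≤ Fintype.card ι)
    (hι₂ : (16 * μhat * (√(4 * (n : ℝ)) + √(2 * Real.log (2 / δ))) / σx) ^ 2 ≤ Fintype.card ι)
    (hι₃ : 2 * ((n : ℝ) + l) * Real.log (1 / δ) ≤ Fintype.card ι) {lam : ℝ}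
    (hlam : ∀ u, lam * ‖u‖ ^ 2
      ≤ ‖u‖ ^ 2 + 4 / (Fintype.card ι * σx ^ 2) * ∑ j, inner ℝ u (μ j) ^ 2) :
    ENNReal.ofReal (1 - 3 * δ) ≤
      P {ω | IsWellConditioned (Fintype.card ι * σx ^ 2 / 8 * lam)
        (√(Fintype.card ι) * constC1 n l σx ση μhat δ / 8) fun j => (x j ω, η j ω)} := by
  have : Nonempty (Fin n) := ⟨⟨0, hn⟩⟩
  have : Nonempty (Fin l) := ⟨⟨0, hl⟩⟩
  have hbad := measure_not_isWellConditioned_le (E := EuclideanSpace ℝ (Fin n))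
    (F := EuclideanSpace ℝ (Fin l)) hσx hση hδ hδ₃ hμ
    (by simpa only [finrank_euclideanSpace_fin] using hι₁)
    (by simpa only [finrank_euclideanSpace_fin] using hι₂)
    (by simpa only [finrank_euclideanSpace_fin] using hι₃) hlam
  simp only [finrank_euclideanSpace_fin] at hbad
  exact ofReal_one_sub_le_measure_preimage (by fun_prop)
    (hasLaw_pi_gaussian hσx.le hση hx hη hindep hindep_pair)
    (isClosed_isWellConditioned _ _).measurableSet (by positivity) hbad

theorem constC1_nonneg (hσx : 0 ≤ σx) (hση : 0 ≤ ση) (hμhat : 0 ≤ μhat) :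
    0 ≤ constC1 n l σx ση μhat δ := by
  rw [constC1]
  positivity

theorem sqrt_mul_div_eight_div_mul {T : ℝ} (hT : 0 < T) (C a b : ℝ) :
    √T * C / 8 / (T * a / 8 * b) = C / (√T * a * b) := by
  rw [mul_div_assoc, mul_assoc, div_mul_eq_mul_div, mul_assoc]
  nth_rw 2 [← Real.mul_self_sqrt hT.le]
  field_simp

end GaussianSample

theorem theorem1_general
    {Ω : Type*} [MeasurableSpace Ω] (P : Measure Ω) [IsProbabilityMeasure P]
    {n l : ℕ} (hn : 0 < n) (hl : 0 < l) (Θ : Matrix (Fin l) (Fin n) ℝ)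
    (σx ση μhat : ℝ) (hσx : 0 < σx) (hση : 0 ≤ ση)
    (μ : ℕ+ → EuclideanSpace ℝ (Fin n)) (hμ : ∀ j, ‖μ j‖ ≤ μhat)
    (x : ℕ+ → Ω → EuclideanSpace ℝ (Fin n)) (η y : ℕ+ → Ω → EuclideanSpace ℝ (Fin l))
    (hx : ∀ j, HasLaw (x j)
      (multivariateGaussian (μ j) (σx ^ 2 • (1 : Matrix (Fin n) (Fin n) ℝ))) P)
    (hη : ∀ j, HasLaw (η j)
      (multivariateGaussian 0 (ση ^ 2 • (1 : Matrix (Fin l) (Fin l) ℝ))) P)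
    (hindep : iIndepFun (fun j ω => (x j ω, η j ω)) P)
    (hindep_pair : ∀ j, IndepFun (x j) (η j) P)
    (hy : ∀ j ω, y j ω = WithLp.toLp 2 (Θ *ᵥ (x j ω).ofLp) + η j ω)
    (δ : ℝ) (hδ : 0 < δ) (t : ℕ+)
    (ht₁ : 8 * (n : ℝ) + 16 * Real.log (2 / δ) ≤ ((t : ℕ) : ℝ))
    (ht₂ : (16 * μhat * (√(4 * (n : ℝ)) + √(2 * Real.log (2 / δ))) / σx) ^ 2 ≤ ((t : ℕ) : ℝ))
    (ht₃ : 2 * ((n : ℝ) + l) * Real.log (1 / δ) ≤ ((t : ℕ) : ℝ)) :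
    ENNReal.ofReal (1 - 3 * δ) ≤
      P {ω | IsUnit (outerSum (fun j => x j ω) (fun j => x j ω) t) ∧
        ‖lsEstimate (fun j => x j ω) (fun j => y j ω) t - Θ‖ ≤
          constC1 n l σx ση μhat δ /
            (√((t : ℕ) : ℝ) * σx ^ 2 * lambdaMin (1 + muBar σx μ t))} := by
  rcases lt_or_ge (1 / 3) δ with hδ₃ | hδ₃
  · rw [ENNReal.ofReal_of_nonpos (by linarith)]
    exact zero_le
  have hcard : Fintype.card (Finset.Icc 1 t) = (t : ℕ) := by
    rw [Fintype.card_coe, PNat.card_Icc, PNat.one_coe, Nat.add_sub_cancel]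
  have : Nonempty (Finset.Icc 1 t) := ⟨⟨1, Finset.mem_Icc.2 ⟨le_rfl, one_le⟩⟩⟩
  have ht : (0 : ℝ) < ((t : ℕ) : ℝ) := Nat.cast_pos.2 t.pos
  have hlam := lambdaMin_pos hn (posDef_one_add_muBar t σx μ)
  have hC : 0 ≤ constC1 n l σx ση μhat δ :=
    constC1_nonneg hσx.le hση ((norm_nonneg _).trans (hμ 1))
  have hlog : 8 * Real.log (1 / δ) ≤ 16 * Real.log (2 / δ) := by
    have h₁ : Real.log (1 / δ) ≤ Real.log (2 / δ) := by gcongr; norm_num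
    linarith [Real.log_nonneg ((one_le_div hδ).2 (hδ₃.trans (by norm_num : (1 / 3 : ℝ) ≤ 2)))]
  have hprob := ofReal_le_measure_isWellConditioned (ι := Finset.Icc 1 t) hn hl hσx hση
    (fun j => hμ j) (fun j => hx j) (fun j => hη j) (hindep.precomp Subtype.val_injective)
    (fun j => hindep_pair j) hδ hδ₃ (by rw [hcard]; linarith) (by rwa [hcard])
    (by rwa [hcard]) (by rw [hcard]; exact lambdaMin_one_add_muBar_mul_norm_sq_le t hn σx μ)
  rw [hcard] at hprob
  refine hprob.trans (measure_mono fun ω (hω : IsWellConditioned _ _ _) => ?_)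
  rw [← sqrt_mul_div_eight_div_mul ht]
  exact ⟨IsWellConditioned.isUnit_outerSum (x := (x · ω)) (η := (η · ω)) hω (by positivity),
    IsWellConditioned.norm_lsEstimate_sub_le (x := (x · ω)) (η := (η · ω)) hω (by positivity)
      (by positivity) fun j => hy j ω⟩

theorem theorem1
    {Ω : Type*} [MeasurableSpace Ω] (P : Measure Ω) [IsProbabilityMeasure P]
    {m n l : ℕ} (hn : 0 < n) (hl : 0 < l)
    (Θ : Matrix (Fin l) (Fin n) ℝ)
    (σx ση μhat : ℝ) (hσx : 0 < σx) (hση : 0 ≤ ση)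
    (μ : Fin m → ℕ+ → EuclideanSpace ℝ (Fin n))
    (hμ : IsLUB (Set.range fun p : Fin m × ℕ+ => ‖μ p.1 p.2‖) μhat)
    (x : Fin m → ℕ+ → Ω → EuclideanSpace ℝ (Fin n))
    (η y : Fin m → ℕ+ → Ω → EuclideanSpace ℝ (Fin l))
    -- the laws of the features and of the noise
    (hx : ∀ i t, HasLaw (x i t)
      (multivariateGaussian (μ i t) (σx ^ 2 • (1 : Matrix (Fin n) (Fin n) ℝ))) P)
    (hη : ∀ i t, HasLaw (η i t)
      (multivariateGaussian 0 (ση ^ 2 • (1 : Matrix (Fin l) (Fin l) ℝ))) P)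
    -- all the features and noises are mutually independent: the pairs `(x i t, η i t)` are
    -- independent over agents and times, and the two members of each pair are independent
    (hindep : iIndepFun (fun (p : Fin m × ℕ+) (ω : Ω) => (x p.1 p.2 ω, η p.1 p.2 ω)) P)
    (hindep_pair : ∀ i t, IndepFun (x i t) (η i t) P)
    -- the observation model `y = Θ x + η`
    (hy : ∀ i t ω, y i t ω = WithLp.toLp 2 (Θ *ᵥ (x i t ω).ofLp) + η i t ω)
    (δ : ℝ) (hδ : 0 < δ) (t : ℕ+)
    (ht₁ : 8 * (n : ℝ) + 16 * Real.log (2 / δ) ≤ ((t : ℕ) : ℝ))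
    (ht₂ : (16 * μhat * (√(4 * (n : ℝ)) + √(2 * Real.log (2 / δ))) / σx) ^ 2 ≤ ((t : ℕ) : ℝ))
    (ht₃ : 2 * ((n : ℝ) + l) * Real.log (1 / δ) ≤ ((t : ℕ) : ℝ))
    (i : Fin m) :
    ENNReal.ofReal (1 - 4 * δ) ≤
      P {ω | IsUnit (outerSum (fun j => x i j ω) (fun j => x i j ω) t) ∧
        ‖lsEstimate (fun j => x i j ω) (fun j => y i j ω) t - Θ‖ ≤
          constC1 n l σx ση μhat δ /
            (√((t : ℕ) : ℝ) * σx ^ 2 * lambdaMin (1 + muBar σx (μ i) t))} :=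
  (ENNReal.ofReal_le_ofReal (by linarith)).trans
    (theorem1_general P hn hl Θ σx ση μhat hσx hση (μ i) (fun j => hμ.1 ⟨(i, j), rfl⟩) (x i) (η i)
      (y i) (hx i) (hη i) (hindep.precomp (Prod.mk_right_injective i)) (hindep_pair i) (hy i) δ hδ
      t ht₁ ht₂ ht₃)
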